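/- A bounded operator $T$ on a complex Hilbert space is a power partial isometry if $T^n$ is a partial isometry for every $n\ge 0$. Let $S$ denote the unilateral shift on $\ell^2=\ell^2(\mathbb{N})$, and for $p\ge 1$ let $J_p$ be the truncated shift on $\mathbb{C}^p$, defined on the usual basis by $J_pe_n=e_{n+1}$ for $n<p$ and $J_pe_p=0$ (so $J_1=0$). All tensor products below are Hilbert space tensor products. Theorem. Let $T_1,\dots,T_M$ be power partial isometries on a complex Hilbert space $H$ that star-commute, that is, $T_mT_n=T_nT_m$ for all $m,n$ and $T_m^*T_n=T_nT_m^*$ for all $m\neq n$. Set $I=\{u,s,b\}\cup\{p\in\mathbb{N}:p\ge 1\}$. For each multi-index $i\in I^M$ let $\Sigma_i=\{m: 1\le m\le M,\ i_m\ne u\}$, and for $m\in\Sigma_i$ put $K_{i,m}=\ell^2$ if $i_m=s$ or $i_m=b$, and $K_{i,m}=\mathbb{C}^p$ if $i_m=p$. Then there are closed subspaces $\{H_i:i\in I^M\}$ of $H$ (possibly zero), each reducing for every $T_m$ (invariant under $T_m$ and $T_m^*$), with $H=\bigoplus_{i\in I^M}H_i$ as an orthogonal Hilbert space direct sum; Hilbert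 spaces $\{M_i:i\in I^M\}$ (possibly zero); and, for each $i$, mutually commuting unitary operators $V_{i,m}$ on $M_i$, one for each $m$ with $i_m=u$; such that for every $i\in I^M$ the family $\{T_m|_{H_i}:1\le m\le M\}$ is simultaneously unitarily equivalent to the following family of operators on $\big(\bigotimes_{n\in\Sigma_i}K_{i,n}\big)\otimes M_i$ (that is, a single unitary $U_i:H_i\to\big(\bigotimes_{n\in\Sigma_i}K_{i,n}\big)\otimes M_i$ conjugates, for every $m$, the operator $T_m|_{H_i}$ to the operator with index $m$): 1. $\big(\bigotimes_{n\in\Sigma_i}1_{K_{i,n}}\big)\otimes V_{i,m}$ if $i_m=u$; 2. $\big(\bigotimes_{n\in\Sigma_i,\,n\ne m}1_{K_{i,n}}\big)\otimes S\otimes 1_{M_i}$ if $i_m=s$; 3. $\big(\bigotimes_{n\in\Sigma_i,\,n\ne m}1_{K_{i,n}}\big)\otimes S^*\otimes 1_{M_i}$ if $i_m=b$; 4. $\big(\bigotimes_{n\in\Sigma_i,\,n\ne m}1_{K_{i,n}}\big)\otimes J_p\otimes 1_{M_i}$ if $i_m=p$; where in items 2--4 the operator $S$, $S^*$ or $J_p$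 acts in the tensor slot $K_{i,m}$. -/

import Mathlib

open scoped TensorProduct InnerProductSpace ComplexOrder

universe u

/-! ### Hadamard products of positive semidefinite matrices and Gram matrices -/

namespace HTensor

theorem posSemidef_prod {κ ι : Type*} [Finite κ] (s : Finset ι) (P : ι → Matrix κ κ ℂ)
    (hP : ∀ i, (P i).PosSemidef) :
    (Matrix.of fun k l => ∏ i ∈ s, P i k l).PosSemidef := by
  classical
  induction s using Finset.induction_on with
  | empty =>
    have h : (Matrix.of fun (k l : κ) => ∏ i ∈ ∅, P i k l)
        = (Matrix.gram ℂ fun _ : κ => (1 : ℂ)) := by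
      ext k l
      simp
    rw [h]
    exact Matrix.posSemidef_gram ℂ _
  | insert a s ha ih =>
    have h : (Matrix.of fun k l => ∏ i ∈ insert a s, P i k l)
        = (P a).hadamard (Matrix.of fun k l => ∏ i ∈ s, P i k l) := by
      ext k l
      simp [Finset.prod_insert ha]
    rw [h]
    exact (hP a).hadamard ih

theorem posSemidef_prod_sub {κ ι : Type*} [Finite κ] (s : Finset ι) (P Q : ι → Matrix κ κ ℂ)
    (hP : ∀ i, (P i).PosSemidef) (hPQ : ∀ i, (Q i - P i).PosSemidef) :
    (Matrix.of fun k l => ∏ i ∈ s, Q i k l - ∏ i ∈ s, P i k l).PosSemidef := by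
  classical
  induction s using Finset.induction_on with
  | empty =>
    convert Matrix.PosSemidef.zero (n := κ) (R := ℂ) using 1
    ext k l
    simp
  | insert a s ha ih =>
    have hQ : (Q a).PosSemidef := by
      have := (hP a).add (hPQ a)
      simpa using this
    have h : (Matrix.of fun k l => ∏ i ∈ insert a s, Q i k l - ∏ i ∈ insert a s, P i k l)
        = (Q a).hadamard (Matrix.of fun k l => ∏ i ∈ s, Q i k l - ∏ i ∈ s, P i k l)
          + (Q a - P a).hadamard (Matrix.of fun k l => ∏ i ∈ s, P i k l) := by
      ext k l
      simp [Finset.prod_insert ha]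
      ring
    rw [h]
    exact (hQ.hadamard ih).add ((hPQ a).hadamard (posSemidef_prod s P hP))

theorem inner_self_eq {E : Type*} [SeminormedAddCommGroup E] [InnerProductSpace ℂ E] (z : E) :
    ⟪z, z⟫_ℂ = ((‖z‖ ^ 2 : ℝ) : ℂ) := by
  rw [inner_self_eq_norm_sq_to_K]
  simp

theorem posSemidef_gram_sub {κ : Type*} [Finite κ] {E F : Type*}
    [NormedAddCommGroup E] [InnerProductSpace ℂ E] [NormedAddCommGroup F] [InnerProductSpace ℂ F]
    (A : E →L[ℂ] F) (v : κ → E) :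
    (((‖A‖ : ℂ) ^ 2) • Matrix.gram ℂ v - Matrix.gram ℂ (fun k => A (v k))).PosSemidef := by
  have := Fintype.ofFinite κ
  refine .of_dotProduct_mulVec_nonneg ?_ fun x => ?_
  · ext k l
    simp [Complex.conj_ofReal, ← Complex.ofReal_pow]
  · rw [Matrix.sub_mulVec, Matrix.smul_mulVec, dotProduct_sub, dotProduct_smul,
      Matrix.star_dotProduct_gram_mulVec, Matrix.star_dotProduct_gram_mulVec]
    have h : ∑ i, x i • A (v i) = A (∑ i, x i • v i) := by simp
    rw [h, inner_self_eq, inner_self_eq]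
    have h2 := A.le_opNorm (∑ i, x i • v i)
    have h3 : ‖A (∑ i, x i • v i)‖ ^ 2 ≤ ‖A‖ ^ 2 * ‖∑ i, x i • v i‖ ^ 2 := by
      rw [← mul_pow]
      exact pow_le_pow_left₀ (norm_nonneg _) h2 2
    rw [smul_eq_mul, sub_nonneg]
    exact_mod_cast h3

/-! ### Hilbert space tensor product of a finite family -/

/-- The algebraic tensor product `⨂ i, E i`; the type synonym carries the inner product below
instead of the projective seminorm of Mathlib. -/
def Alg {ι : Type*} (E : ι → Type*) [∀ i, AddCommGroup (E i)] [∀ i, Module ℂ (E i)] : Type _ :=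
  ⨂[ℂ] i, E i

section Pi

variable {ι : Type*} (E : ι → Type*)

noncomputable instance [∀ i, AddCommGroup (E i)] [∀ i, Module ℂ (E i)] : AddCommGroup (Alg E) :=
  inferInstanceAs (AddCommGroup (⨂[ℂ] i, E i))

noncomputable instance [∀ i, AddCommGroup (E i)] [∀ i, Module ℂ (E i)] : Module ℂ (Alg E) :=
  inferInstanceAs (Module ℂ (⨂[ℂ] i, E i))

section Algebra

variable [∀ i, AddCommGroup (E i)] [∀ i, Module ℂ (E i)]

/-- Elementary tensors in the algebraic tensor product. -/
noncomputable def Alg.tprod : MultilinearMap ℂ E (Alg E) := PiTensorProduct.tprod ℂ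

variable {E}

theorem Alg.exists_rep (z : Alg E) :
    ∃ c : (∀ i, E i) →₀ ℂ, z = ∑ k : c.support, c k • Alg.tprod E k := by
  have hz : z ∈ Submodule.span ℂ (Set.range (Alg.tprod E)) := by
    have : Submodule.span ℂ (Set.range (Alg.tprod E)) = ⊤ :=
      PiTensorProduct.span_tprod_eq_top (R := ℂ) (s := E)
    exact this ▸ Submodule.mem_top
  obtain ⟨c, hc⟩ := Finsupp.mem_span_range_iff_exists_finsupp.1 hz
  refine ⟨c, ?_⟩
  rw [← hc, Finsupp.sum, ← Finset.sum_coe_sort]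

/-- The linear map on the algebraic tensor product that a multilinear map induces. -/
noncomputable def Alg.lift {F : Type*} [AddCommGroup F] [Module ℂ F] (f : MultilinearMap ℂ E F) :
    Alg E →ₗ[ℂ] F :=
  PiTensorProduct.lift f

theorem Alg.lift_tprod {F : Type*} [AddCommGroup F] [Module ℂ F] (f : MultilinearMap ℂ E F)
    (x : ∀ i, E i) : Alg.lift f (Alg.tprod E x) = f x :=
  PiTensorProduct.lift.tprod x

theorem Alg.hom_ext {f g : Alg E →ₗ⋆[ℂ] ℂ}
    (h : ∀ x, f (Alg.tprod E x) = g (Alg.tprod E x)) : f = g := by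
  ext z
  obtain ⟨c, rfl⟩ := Alg.exists_rep z
  simp [h]

/-- The linear map `⨂ i, A i` on the algebraic tensor product. -/
noncomputable def Alg.mapLin (A : ∀ i, E i →ₗ[ℂ] E i) : Alg E →ₗ[ℂ] Alg E :=
  Alg.lift ((Alg.tprod E).compLinearMap A)

theorem Alg.mapLin_tprod (A : ∀ i, E i →ₗ[ℂ] E i) (x : ∀ i, E i) :
    Alg.mapLin A (Alg.tprod E x) = Alg.tprod E fun i => A i (x i) :=
  Alg.lift_tprod _ x

end Algebra

variable {E} [∀ i, NormedAddCommGroup (E i)] [∀ i, InnerProductSpace ℂ (E i)] [Fintype ι]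

/-- The linear functional `w ↦ ∏ i, ⟪x i, w i⟫` on the algebraic tensor product. -/
noncomputable def Alg.innerRight (x : ∀ i, E i) : Alg E →ₗ[ℂ] ℂ :=
  Alg.lift
    ((MultilinearMap.mkPiAlgebra ℂ ι ℂ).compLinearMap fun i => innerₛₗ ℂ (x i))

theorem Alg.innerRight_tprod (x y : ∀ i, E i) :
    Alg.innerRight x (Alg.tprod E y) = ∏ i, ⟪x i, y i⟫_ℂ := by
  simp [Alg.innerRight, Alg.lift_tprod]

/-- The conjugate-linear functional `z ↦ ∏ i, ⟪z i, y i⟫` on the algebraic tensor product. -/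
noncomputable def Alg.innerLeft (y : ∀ i, E i) : Alg E →ₗ⋆[ℂ] ℂ :=
  (starLinearEquiv ℂ (A := ℂ)).toLinearMap.comp (Alg.innerRight y)

theorem Alg.innerLeft_apply (y : ∀ i, E i) (z : Alg E) :
    Alg.innerLeft y z = star (Alg.innerRight y z) := rfl

theorem Alg.innerLeft_tprod (x y : ∀ i, E i) :
    Alg.innerLeft y (Alg.tprod E x) = ∏ i, ⟪x i, y i⟫_ℂ := by
  simp [Alg.innerLeft_apply, Alg.innerRight_tprod]

/-- `y ↦ (z ↦ ∏ i, ⟪z i, y i⟫)` as a multilinear map. -/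
noncomputable def Alg.innerMulti : MultilinearMap ℂ E (Alg E →ₗ⋆[ℂ] ℂ) where
  toFun := Alg.innerLeft
  map_update_add' y i a b := by
    refine Alg.hom_ext fun x => ?_
    have := (((MultilinearMap.mkPiAlgebra ℂ ι ℂ).compLinearMap
      fun i => innerₛₗ ℂ (x i))).map_update_add y i a b
    simpa only [Alg.innerLeft_tprod, LinearMap.add_apply, LinearMap.smul_apply,
      MultilinearMap.compLinearMap_apply, MultilinearMap.mkPiAlgebra_apply, innerₛₗ_apply_apply]
      using this
  map_update_smul' y i a b := by
    refine Alg.hom_ext fun x => ?_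
    have := (((MultilinearMap.mkPiAlgebra ℂ ι ℂ).compLinearMap
      fun i => innerₛₗ ℂ (x i))).map_update_smul y i a b
    simpa only [Alg.innerLeft_tprod, LinearMap.add_apply, LinearMap.smul_apply,
      MultilinearMap.compLinearMap_apply, MultilinearMap.mkPiAlgebra_apply, innerₛₗ_apply_apply]
      using this

/-- The sesquilinear form of the inner product, with the arguments swapped. -/
noncomputable def Alg.form : Alg E →ₗ[ℂ] (Alg E →ₗ⋆[ℂ] ℂ) := Alg.lift Alg.innerMulti

/-- The inner product on the algebraic tensor product, determined by
`⟪⨂ x i, ⨂ y i⟫ = ∏ i, ⟪x i, y i⟫`. -/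
noncomputable instance Alg.instInner : Inner ℂ (Alg E) where
  inner z w := Alg.form w z

theorem Alg.inner_add_left' (x y z : Alg E) : ⟪x + y, z⟫_ℂ = ⟪x, z⟫_ℂ + ⟪y, z⟫_ℂ :=
  map_add _ _ _

theorem Alg.inner_smul_left' (x z : Alg E) (c : ℂ) : ⟪c • x, z⟫_ℂ = star c * ⟪x, z⟫_ℂ :=
  LinearMap.map_smulₛₗ _ _ _

theorem Alg.inner_add_right' (x y z : Alg E) : ⟪x, y + z⟫_ℂ = ⟪x, y⟫_ℂ + ⟪x, z⟫_ℂ := by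
  change Alg.form _ _ = _
  rw [map_add]
  rfl

theorem Alg.inner_smul_right' (x z : Alg E) (c : ℂ) : ⟪x, c • z⟫_ℂ = c * ⟪x, z⟫_ℂ := by
  change Alg.form _ _ = _
  rw [map_smul]
  rfl

theorem Alg.inner_tprod (x y : ∀ i, E i) :
    ⟪Alg.tprod E x, Alg.tprod E y⟫_ℂ = ∏ i, ⟪x i, y i⟫_ℂ := by
  have h : Alg.form (Alg.tprod E y)
      = Alg.innerLeft y := Alg.lift_tprod _ y
  rw [← Alg.innerLeft_tprod, ← h]
  rfl

theorem Alg.inner_sum_sum {κ κ' : Type*} [Fintype κ] [Fintype κ'] (c : κ → ℂ) (d : κ' → ℂ)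
    (x : κ → ∀ i, E i) (y : κ' → ∀ i, E i) :
    ⟪∑ k, c k • Alg.tprod E (x k), ∑ l, d l • Alg.tprod E (y l)⟫_ℂ
      = ∑ k, ∑ l, star (c k) * d l * ∏ i, ⟪x k i, y l i⟫_ℂ := by
  have h1 : ∀ w : Alg E, ⟪∑ k, c k • Alg.tprod E (x k), w⟫_ℂ
      = ∑ k, star (c k) * ⟪Alg.tprod E (x k), w⟫_ℂ := by
    intro w
    have := map_sum (Alg.form w)
      (fun k => c k • Alg.tprod E (x k)) Finset.univ
    refine this.trans (Finset.sum_congr rfl fun k _ => ?_)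
    exact Alg.inner_smul_left' _ _ _
  rw [h1]
  refine Finset.sum_congr rfl fun k _ => ?_
  have h2 : ⟪Alg.tprod E (x k), ∑ l, d l • Alg.tprod E (y l)⟫_ℂ
      = ∑ l, d l * ⟪Alg.tprod E (x k), Alg.tprod E (y l)⟫_ℂ := by
    change Alg.form _ _ = _
    rw [map_sum, LinearMap.sum_apply]
    refine Finset.sum_congr rfl fun l _ => ?_
    exact Alg.inner_smul_right' _ _ _
  rw [h2, Finset.mul_sum]
  simp only [Alg.inner_tprod, mul_assoc]

theorem Alg.inner_sum_eq {κ : Type*} [Fintype κ] (c : κ → ℂ) (x : κ → ∀ i, E i) :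
    ⟪∑ k, c k • Alg.tprod E (x k), ∑ k, c k • Alg.tprod E (x k)⟫_ℂ
      = star c ⬝ᵥ (Matrix.of fun k l => ∏ i, Matrix.gram ℂ (fun k => x k i) k l).mulVec c := by
  rw [Alg.inner_sum_sum]
  simp only [dotProduct, Matrix.mulVec, Finset.mul_sum]
  refine Finset.sum_congr rfl fun k _ => Finset.sum_congr rfl fun l _ => ?_
  simp
  ring

theorem Alg.inner_self_nonneg' (z : Alg E) : 0 ≤ ⟪z, z⟫_ℂ := by
  obtain ⟨c, rfl⟩ := Alg.exists_rep z
  rw [Alg.inner_sum_eq (fun k : c.support => c k) (fun k : c.support => (k : ∀ i, E i))]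
  exact (posSemidef_prod Finset.univ
    (fun i => Matrix.gram ℂ fun k : c.support => (k : ∀ i, E i) i)
    fun i => Matrix.posSemidef_gram ℂ _).dotProduct_mulVec_nonneg _

/-- The inner product axioms on the algebraic tensor product. -/
@[reducible]
noncomputable def Alg.core : PreInnerProductSpace.Core ℂ (Alg E) where
  inner := inner ℂ
  conj_inner_symm z w := by
    obtain ⟨c, rfl⟩ := Alg.exists_rep z
    obtain ⟨d, rfl⟩ := Alg.exists_rep w
    rw [Alg.inner_sum_sum (fun k : c.support => c k) (fun k : d.support => d k)
        (fun k : c.support => (k : ∀ i, E i)) (fun k : d.support => (k : ∀ i, E i)),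
      Alg.inner_sum_sum (fun k : d.support => d k) (fun k : c.support => c k)
        (fun k : d.support => (k : ∀ i, E i)) (fun k : c.support => (k : ∀ i, E i)),
      Finset.sum_comm]
    simp [mul_comm]
  re_inner_nonneg z := (Complex.le_def.1 (Alg.inner_self_nonneg' z)).1
  add_left := Alg.inner_add_left'
  smul_left x y r := Alg.inner_smul_left' x y r

noncomputable instance : SeminormedAddCommGroup (Alg E) :=
  letI := Alg.core (E := E)
  InnerProductSpace.Core.toSeminormedAddCommGroup (𝕜 := ℂ)

noncomputable instance : InnerProductSpace ℂ (Alg E) :=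
  InnerProductSpace.ofCore Alg.core

variable (E) in
/-- The Hilbert space tensor product `⨂ i, E i` of a finite family of Hilbert spaces: the completion
of the algebraic tensor product. -/
abbrev PiHilbert : Type _ := UniformSpace.Completion (Alg E)

theorem Alg.norm_map_le (A : ∀ i, E i →L[ℂ] E i) (z : Alg E) :
    ‖Alg.mapLin (fun i => (A i : E i →ₗ[ℂ] E i)) z‖
      ≤ (∏ i, ‖A i‖) * ‖z‖ := by
  refine le_of_sq_le_sq ?_ (by positivity)
  obtain ⟨c, rfl⟩ := Alg.exists_rep z
  have hmap : Alg.mapLin (fun i => (A i : E i →ₗ[ℂ] E i))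
      (∑ k : c.support, c k • Alg.tprod E k)
      = ∑ k : c.support, c k • Alg.tprod E (fun i => A i ((k : ∀ i, E i) i)) := by
    rw [map_sum]
    refine Finset.sum_congr rfl fun k _ => ?_
    rw [map_smul]
    congr 1
    exact Alg.mapLin_tprod _ _
  rw [hmap, mul_pow, ← Finset.prod_pow]
  have key := (posSemidef_prod_sub Finset.univ
    (fun i => Matrix.gram ℂ fun k : c.support => A i ((k : ∀ i, E i) i))
    (fun i => ((‖A i‖ : ℂ) ^ 2) • Matrix.gram ℂ fun k : c.support => (k : ∀ i, E i) i)
    (fun i => Matrix.posSemidef_gram ℂ _)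
    (fun i => posSemidef_gram_sub (A i) _)).dotProduct_mulVec_nonneg (fun k => c k)
  have hsplit : (Matrix.of fun k l : c.support =>
        ∏ i, (((‖A i‖ : ℂ) ^ 2) • Matrix.gram ℂ fun k : c.support => (k : ∀ i, E i) i) k l
        - ∏ i, (Matrix.gram ℂ fun k : c.support => A i ((k : ∀ i, E i) i)) k l)
      = (∏ i, (‖A i‖ : ℂ) ^ 2) • (Matrix.of fun k l : c.support =>
          ∏ i, (Matrix.gram ℂ fun k : c.support => (k : ∀ i, E i) i) k l)
        - Matrix.of fun k l : c.support =>
          ∏ i, (Matrix.gram ℂ fun k : c.support => A i ((k : ∀ i, E i) i)) k l := by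
    ext k l
    simp [Finset.prod_mul_distrib]
  rw [hsplit, Matrix.sub_mulVec, Matrix.smul_mulVec, dotProduct_sub, dotProduct_smul,
    ← Alg.inner_sum_eq (fun k : c.support => c k) (fun k : c.support => (k : ∀ i, E i)),
    ← Alg.inner_sum_eq (fun k : c.support => c k)
      (fun (k : c.support) i => A i ((k : ∀ i, E i) i)), sub_nonneg,
    inner_self_eq, inner_self_eq, smul_eq_mul] at key
  exact_mod_cast key

/-- The bounded operator `⨂ i, A i` on the algebraic tensor product. -/
noncomputable def Alg.map (A : ∀ i, E i →L[ℂ] E i) : Alg E →L[ℂ] Alg E :=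
  LinearMap.mkContinuous (Alg.mapLin (fun i => (A i : E i →ₗ[ℂ] E i)))
    (∏ i, ‖A i‖) (Alg.norm_map_le A)

/-- The bounded operator `⨂ i, A i` on the Hilbert space tensor product. -/
noncomputable def PiHilbert.map (A : ∀ i, E i →L[ℂ] E i) : PiHilbert E →L[ℂ] PiHilbert E :=
  (Alg.map A).completion

end Pi

/-! ### Hilbert space tensor product of two Hilbert spaces -/

section Binary

variable (E F : Type*) [NormedAddCommGroup E] [InnerProductSpace ℂ E]
  [NormedAddCommGroup F] [InnerProductSpace ℂ F]

/-- The Hilbert space tensor product of two Hilbert spaces. -/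
abbrev Tensor : Type _ := UniformSpace.Completion (E ⊗[ℂ] F)

variable {E F}

theorem exists_rep_tmul (z : E ⊗[ℂ] F) :
    ∃ (n : ℕ) (x : Fin n → E) (y : Fin n → F), z = ∑ k, x k ⊗ₜ[ℂ] y k := by
  induction z using TensorProduct.induction_on with
  | zero => exact ⟨0, Fin.elim0, Fin.elim0, by simp⟩
  | tmul x y => exact ⟨1, fun _ => x, fun _ => y, by simp⟩
  | add z w hz hw =>
    obtain ⟨n, x, y, rfl⟩ := hz
    obtain ⟨m, x', y', rfl⟩ := hw
    exact ⟨n + m, Fin.append x x', Fin.append y y', by simp [Fin.sum_univ_add]⟩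

theorem inner_sum_tmul {n : ℕ} (x : Fin n → E) (y : Fin n → F) :
    ((‖∑ k, x k ⊗ₜ[ℂ] y k‖ ^ 2 : ℝ) : ℂ)
      = star (1 : Fin n → ℂ) ⬝ᵥ (Matrix.hadamard (Matrix.gram ℂ x) (Matrix.gram ℂ y)).mulVec 1 := by
  rw [← inner_self_eq]
  simp only [sum_inner, inner_sum, dotProduct, Matrix.mulVec]
  simp only [TensorProduct.inner_tmul]
  rw [Finset.sum_comm]
  simp

theorem norm_map_tmul_le (A : E →L[ℂ] E) (B : F →L[ℂ] F) (z : E ⊗[ℂ] F) :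
    ‖TensorProduct.map (A : E →ₗ[ℂ] E) (B : F →ₗ[ℂ] F) z‖ ≤ (‖A‖ * ‖B‖) * ‖z‖ := by
  refine le_of_sq_le_sq ?_ (by positivity)
  obtain ⟨n, x, y, rfl⟩ := exists_rep_tmul z
  have hmap : TensorProduct.map (A : E →ₗ[ℂ] E) (B : F →ₗ[ℂ] F) (∑ k, x k ⊗ₜ[ℂ] y k)
      = ∑ k, A (x k) ⊗ₜ[ℂ] B (y k) := by simp
  rw [hmap, mul_pow]
  have hA := posSemidef_gram_sub A x
  have hB := posSemidef_gram_sub B y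
  have hQ : (((‖A‖ : ℂ) ^ 2) • Matrix.gram ℂ x).PosSemidef := by
    simpa using hA.add (Matrix.posSemidef_gram ℂ fun k => A (x k))
  have key := ((hQ.hadamard hB).add
    (hA.hadamard (Matrix.posSemidef_gram ℂ fun k => B (y k)))).dotProduct_mulVec_nonneg 1
  have hsplit : Matrix.hadamard (((‖A‖ : ℂ) ^ 2) • Matrix.gram ℂ x)
        (((‖B‖ : ℂ) ^ 2) • Matrix.gram ℂ y - Matrix.gram ℂ fun k => B (y k))
      + Matrix.hadamard (((‖A‖ : ℂ) ^ 2) • Matrix.gram ℂ x - Matrix.gram ℂ fun k => A (x k))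
        (Matrix.gram ℂ fun k => B (y k))
      = ((‖A‖ : ℂ) ^ 2 * (‖B‖ : ℂ) ^ 2) • Matrix.hadamard (Matrix.gram ℂ x) (Matrix.gram ℂ y)
        - Matrix.hadamard (Matrix.gram ℂ fun k => A (x k)) (Matrix.gram ℂ fun k => B (y k)) := by
    ext k l
    simp
    ring
  rw [hsplit, Matrix.sub_mulVec, Matrix.smul_mulVec, dotProduct_sub, dotProduct_smul,
    ← inner_sum_tmul, ← inner_sum_tmul, sub_nonneg, smul_eq_mul] at key
  have key' : ‖∑ k, A (x k) ⊗ₜ[ℂ] B (y k)‖ ^ 2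
      ≤ (‖A‖ ^ 2 * ‖B‖ ^ 2) * ‖∑ k, x k ⊗ₜ[ℂ] y k‖ ^ 2 := by exact_mod_cast key
  rwa [mul_pow]

/-- The bounded operator `A ⊗ B` on the Hilbert space tensor product. -/
noncomputable def Tensor.map (A : E →L[ℂ] E) (B : F →L[ℂ] F) : Tensor E F →L[ℂ] Tensor E F :=
  (LinearMap.mkContinuous (TensorProduct.map (A : E →ₗ[ℂ] E) (B : F →ₗ[ℂ] F)) (‖A‖ * ‖B‖)
    (norm_map_tmul_le A B)).completion

end Binary

end HTensor

/-! ### Power partial isometries, reducing subspaces, unitary equivalence -/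

namespace StarPPI

section Basic

variable {H : Type*} [NormedAddCommGroup H] [InnerProductSpace ℂ H]

/-- `V` is a partial isometry: it is isometric on the orthogonal complement of its kernel. -/
def IsPartialIsometry (V : H →L[ℂ] H) : Prop :=
  ∀ x ∈ (LinearMap.ker (V : H →ₗ[ℂ] H))ᗮ, ‖V x‖ = ‖x‖

/-- `T` is a power partial isometry: all its powers are partial isometries. -/
def IsPowerPartialIsometry (T : H →L[ℂ] H) : Prop :=
  ∀ n : ℕ, IsPartialIsometry (T ^ n)

variable [CompleteSpace H]

/-- The family `T` star-commutes. -/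
def StarCommuting {ι : Type*} (T : ι → H →L[ℂ] H) : Prop :=
  (∀ m n, T m * T n = T n * T m) ∧
    ∀ m n, m ≠ n → ContinuousLinearMap.adjoint (T m) * T n = T n * ContinuousLinearMap.adjoint (T m)

/-- The subspace `L` is reducing for `T`: it is invariant under `T` and under `T*`. -/
def Reducing (L : Submodule ℂ H) (T : H →L[ℂ] H) : Prop :=
  (∀ x ∈ L, T x ∈ L) ∧ ∀ x ∈ L, ContinuousLinearMap.adjoint T x ∈ L

end Basic

/-- Two families of bounded operators are simultaneously unitarily equivalent. -/
def SimUnitarilyEquiv {ι H K : Type*} [NormedAddCommGroup H] [InnerProductSpace ℂ H]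
    [NormedAddCommGroup K] [InnerProductSpace ℂ K]
    (T : ι → H →L[ℂ] H) (S : ι → K →L[ℂ] K) : Prop :=
  ∃ U : H ≃ₗᵢ[ℂ] K, ∀ m x, U (T m (U.symm x)) = S m x

/-! ### Shifts -/

/-- The Hilbert space `ℓ²` over `ℕ = {0, 1, 2, …}`. -/
abbrev Ell2 : Type := lp (fun _ : ℕ => ℂ) 2

/-- The sequence `(0, x 0, x 1, x 2, …)`. -/
def shiftFun (x : ℕ → ℂ) : ℕ → ℂ
  | 0 => 0
  | n + 1 => x n

theorem hasSum_shiftFun (x : Ell2) :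
    HasSum (fun n => ‖shiftFun x n‖ ^ (2 : ENNReal).toReal) (‖x‖ ^ (2 : ENNReal).toReal) := by
  have h := lp.hasSum_norm (p := 2) (by norm_num) x
  rw [← hasSum_nat_add_iff' 1]
  simpa [shiftFun] using h

theorem memℓp_shiftFun (x : Ell2) : Memℓp (shiftFun x) 2 :=
  memℓp_gen (hasSum_shiftFun x).summable

/-- The unilateral shift `S` on `ℓ²`, `(x 0, x 1, …) ↦ (0, x 0, x 1, …)`. -/
noncomputable def shift : Ell2 →L[ℂ] Ell2 :=
  LinearMap.mkContinuous
    { toFun := fun x => ⟨shiftFun x, memℓp_shiftFun x⟩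
      map_add' := fun x y => by
        ext n
        change shiftFun (x + y : Ell2) n = shiftFun x n + shiftFun y n
        cases n <;> simp [shiftFun]
      map_smul' := fun c x => by
        ext n
        change shiftFun (c • x : Ell2) n = c * shiftFun x n
        cases n <;> simp [shiftFun] }
    1 (fun x => by
      have h1 := lp.hasSum_norm (p := 2) (by norm_num) (⟨shiftFun x, memℓp_shiftFun x⟩ : Ell2)
      have h2 := h1.unique (hasSum_shiftFun x)
      simp only [ENNReal.toReal_ofNat, Real.rpow_ofNat] at h2
      have h3 := (sq_eq_sq₀ (norm_nonneg _) (norm_nonneg _)).1 h2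
      rw [one_mul]
      exact h3.le)

/-- The truncated shift `J_p` on `ℂ^p`, `(x 0, …, x (p - 1)) ↦ (0, x 0, …, x (p - 2))`; that is,
`e_k ↦ e_{k + 1}` for `k + 1 < p` and `e_{p - 1} ↦ 0`. -/
noncomputable def truncShift (p : ℕ) : EuclideanSpace ℂ (Fin p) →L[ℂ] EuclideanSpace ℂ (Fin p) :=
  LinearMap.toContinuousLinearMap
    { toFun := fun x => WithLp.toLp 2 fun n : Fin p =>
        if (n : ℕ) = 0 then 0 else x ⟨(n : ℕ) - 1, lt_of_le_of_lt (Nat.sub_le _ _) n.2⟩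
      map_add' := fun x y => by
        ext n
        by_cases h : (n : ℕ) = 0 <;> simp [h]
      map_smul' := fun c x => by
        ext n
        by_cases h : (n : ℕ) = 0 <;> simp [h] }

/-! ### The models -/

/-- The index set `I = {u, s, b} ∪ {p : p ≥ 1}`. -/
inductive Label : Type
  /-- unitary -/
  | u : Label
  /-- forward shift -/
  | s : Label
  /-- backward shift -/
  | b : Label
  /-- truncated shift on `ℂ^p`, `p ≥ 1` -/
  | trunc (p : ℕ+) : Label

/-- The Hilbert space attached to a label: `ℓ²` for `s` and `b`, and `ℂ^p` for `p`. The value at `u`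
is a placeholder; it is never used, since the models only have slots with label `≠ u`. -/
def Label.space : Label → Type
  | .u => EuclideanSpace ℂ (Fin 0)
  | .s => Ell2
  | .b => Ell2
  | .trunc p => EuclideanSpace ℂ (Fin p)

noncomputable instance : ∀ l : Label, NormedAddCommGroup l.space
  | .u => inferInstanceAs (NormedAddCommGroup (EuclideanSpace ℂ (Fin 0)))
  | .s => inferInstanceAs (NormedAddCommGroup Ell2)
  | .b => inferInstanceAs (NormedAddCommGroup Ell2)
  | .trunc p => inferInstanceAs (NormedAddCommGroup (EuclideanSpace ℂ (Fin p)))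

noncomputable instance : ∀ l : Label, InnerProductSpace ℂ l.space
  | .u => inferInstanceAs (InnerProductSpace ℂ (EuclideanSpace ℂ (Fin 0)))
  | .s => inferInstanceAs (InnerProductSpace ℂ Ell2)
  | .b => inferInstanceAs (InnerProductSpace ℂ Ell2)
  | .trunc p => inferInstanceAs (InnerProductSpace ℂ (EuclideanSpace ℂ (Fin p)))

/-- The operator attached to a label: `S` for `s`, `S*` for `b` and `J_p` for `p` (the value at `u`
is a placeholder that is never used). -/
noncomputable def Label.op : ∀ l : Label, l.space →L[ℂ] l.space
  | .u => (0 : EuclideanSpace ℂ (Fin 0) →L[ℂ] EuclideanSpace ℂ (Fin 0))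
  | .s => (shift : Ell2 →L[ℂ] Ell2)
  | .b => (ContinuousLinearMap.adjoint shift : Ell2 →L[ℂ] Ell2)
  | .trunc p => (truncShift p : EuclideanSpace ℂ (Fin p) →L[ℂ] EuclideanSpace ℂ (Fin p))

variable {M : ℕ}

/-- The set `Σ_i` of slots `m` with `i m ≠ u`. -/
abbrev Slots (i : Fin M → Label) : Type := {m : Fin M // i m ≠ Label.u}

noncomputable instance (i : Fin M → Label) : Fintype (Slots i) := Fintype.ofFinite _

/-- The Hilbert space `⨂_{n ∈ Σ_i} K_{i,n}`. -/
abbrev SlotSpace (i : Fin M → Label) : Type := HTensor.PiHilbert fun n : Slots i => (i n).space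

/-- The operator on `⨂_{n ∈ Σ_i} K_{i,n}` that is the tensor product of the operator attached to the
label `i m` in the slot `m` and of the identities in all the other slots. -/
noncomputable def slotOp (i : Fin M → Label) (m : Slots i) : SlotSpace i →L[ℂ] SlotSpace i :=
  HTensor.PiHilbert.map (Function.update
    (fun n : Slots i => ContinuousLinearMap.id ℂ (i n).space) m (i m).op)

open Classical in
/-- The model family on `(⨂_{n ∈ Σ_i} K_{i,n}) ⊗ N`: the operator with index `m` is `1 ⊗ V m` if
`i m = u`, and otherwise acts as `S`, `S*` or `J_p` in the slot `m` and as the identity in all the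
other slots and on `N`. -/
noncomputable def modelOp (i : Fin M → Label) {N : Type*} [NormedAddCommGroup N]
    [InnerProductSpace ℂ N] (V : {m : Fin M // i m = Label.u} → N →L[ℂ] N) (m : Fin M) :
    HTensor.Tensor (SlotSpace i) N →L[ℂ] HTensor.Tensor (SlotSpace i) N :=
  if h : i m = Label.u then HTensor.Tensor.map (ContinuousLinearMap.id ℂ (SlotSpace i)) (V ⟨m, h⟩)
  else HTensor.Tensor.map (slotOp i ⟨m, h⟩) (ContinuousLinearMap.id ℂ N)

end StarPPI

open StarPPI

/-! Every `T m` yields two decreasing chains of projections: the initial projections of its powers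
and those of the powers of its adjoint. The two chains of one operator commute by the Halmos–Wallen
argument (`commute_initial_final`), and chains of different operators commute by star-commutation.
Each vector then splits along the joint levels of finitely many commuting chains: a level `α` in
`ℕ∞` for each chain records how long the vector stays in the ranges of its projections. The joint
levels are mutually orthogonal and total (`inner_jointLevel_eq_zero`,
`eq_zero_of_forall_jointLevel`).

Let `a` and `b` be the levels of a vector for `T m` and for its adjoint, that is, how often each can
be applied isometrically. Then `T m` kills the vector if `a = 0`, and otherwise moves it
isometrically to levels `a - 1` and `b + 1`, leaving all other levels alone (`signedOp_mem`). The
orbits of `(a, b)` under this move are exactly the labels: `(⊤, ⊤)` is fixed and gives `u`; `(⊤, b)`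
runs upwards from `(⊤, 0)` and gives `s`; `(a, ⊤)` is the mirror image and gives `b`; for finite `a`
and `b` the sum is constant and equal to `p - 1`, which gives the truncated shift. Pairs of levels
therefore correspond bijectively to a label with a valid position (`Label.pos_injective`,
`Label.exists_pos_eq`).

The space `H_i` is the closed span of the joint levels whose labels are `i`, and `M_i` is the joint
level at position `0`. Words in the `T m` or their adjoints carry `M_i` isometrically onto the level
at position `k` (`orbitWord_spec`), just as `x ↦ e_k ⊗ x` embeds `M_i` in the model. Matching these
two orthogonal families gives the unitary, and the intertwining relation is checked on the vectors
`e_k ⊗ x`. -/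

namespace StarPPI

/-! ### Initial and final projections of powers -/

section Algebra

/-- Halmos and Wallen: if `v`, `w` and `v * w` are partial isometries, then the initial projection
of `v` commutes with the final projection of `w`. -/
theorem commute_initial_final {R : Type*} [NormedRing R] [StarRing R] [CStarRing R] {v w : R}
    (hv : v * star v * v = v) (hw : w * star w * w = w)
    (hvw : v * w * star (v * w) * (v * w) = v * w) :
    Commute (star v * v) (w * star w) := by
  set e := star v * v with he
  set f := w * star w with hf
  have hes : star e = e := by simp [he]
  have hfs : star f = f := by simp [hf]
  have hee : e * e = e := by
    rw [he, ← mul_assoc, mul_assoc (star v), mul_assoc (star v), hv]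
  have hff : f * f = f := by rw [hf, ← mul_assoc, hw]
  -- Multiplying the identity for `v * w` by `star v` on the left and `star w` on the right makes `e
  -- * f` idempotent.
  have hefef : e * f * (e * f) = e * f := by
    have h := congrArg (fun x => star v * x * star w) hvw
    simp only [star_mul] at h
    simp only [he, hf]
    simpa only [mul_assoc] using h
  -- An idempotent product of two projections is self-adjoint: `x = e * f - e * f * e` satisfies `x
  -- * star x = 0`, so the C*-identity gives `x = 0`.
  have h : (e * f - e * f * e) = 0 := by
    rw [← CStarRing.mul_star_self_eq_zero_iff]
    have h1 : star (e * f - e * f * e) = f * e - e * f * e := by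
      simp [hes, hfs, mul_assoc]
    rw [h1]
    have h2 : (e * f - e * f * e) * (f * e - e * f * e)
        = e * (f * f) * e - e * f * (e * f) * e - e * f * (e * f) * e
          + e * f * (e * e) * f * e := by
      noncomm_ring
    have h3 : e * f * e * f * e = e * f * e := by rw [mul_assoc (e * f) e f, hefef]
    rw [h2, hff, hefef, hee, h3]
    simp
  have h' : e * f = e * f * e := sub_eq_zero.1 h
  have h'' : f * e = e * f * e := by
    have := congrArg star h'
    simpa [hes, hfs, mul_assoc] using this
  exact h'.trans h''.symm

/-- All powers of `t` are partial isometries, in terms of the algebra. -/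
def IsPowerPartialIsom {R : Type*} [Monoid R] [StarMul R] (t : R) : Prop :=
  ∀ n : ℕ, t ^ n * star (t ^ n) * t ^ n = t ^ n

/-- The initial projection of `t ^ n`. -/
def initProj {R : Type*} [Monoid R] [StarMul R] (t : R) (n : ℕ) : R := star (t ^ n) * t ^ n

section Monoid

variable {R : Type*} [Monoid R] [StarMul R] {t : R}

theorem IsPowerPartialIsom.star_mem (ht : IsPowerPartialIsom t) : IsPowerPartialIsom (star t) := by
  intro n
  have := congrArg star (ht n)
  simpa [mul_assoc] using this

theorem initProj_zero : initProj t 0 = 1 := by simp [initProj]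

theorem star_initProj (n : ℕ) : star (initProj t n) = initProj t n := by simp [initProj]

theorem IsPowerPartialIsom.initProj_mul (ht : IsPowerPartialIsom t) {m n : ℕ} (h : m ≤ n) :
    initProj t n * initProj t m = initProj t n := by
  obtain ⟨k, rfl⟩ := Nat.exists_eq_add_of_le' h
  simp only [initProj, pow_add]
  have := ht m
  simp only [mul_assoc] at this ⊢
  rw [this]

theorem IsPowerPartialIsom.initProj_mul' (ht : IsPowerPartialIsom t) {m n : ℕ} (h : m ≤ n) :
    initProj t m * initProj t n = initProj t n := by
  have := congrArg star (ht.initProj_mul h)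
  simpa [star_initProj] using this

theorem commute_initProj {s : R} (h1 : Commute t s) (h2 : Commute (star t) s) (n : ℕ) :
    Commute (initProj t n) s := by
  rw [initProj, star_pow]
  exact (h2.pow_left n).mul_left (h1.pow_left n)

end Monoid

variable {R : Type*} [NormedRing R] [StarRing R] [CStarRing R] {t : R}

/-- Halmos–Wallen applies to `v = t ^ m` and `w = t ^ n`, since their product is again a power of
`t`. -/
theorem IsPowerPartialIsom.commute_initProj_star (ht : IsPowerPartialIsom t) (m n : ℕ) :
    Commute (initProj t m) (initProj (star t) n) := by
  have h := commute_initial_final (ht m) (ht n) (by rw [← pow_add]; exact ht (m + n))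
  simpa [initProj] using h

/-- The left side is `(t * star t) * initProj t n * t`; the final projection `t * star t` commutes
past `initProj t n` and is absorbed by `t`. This is why one application of `t` lowers its own level
by one. -/
theorem IsPowerPartialIsom.mul_initProj_succ (ht : IsPowerPartialIsom t) (n : ℕ) :
    t * initProj t (n + 1) = initProj t n * t := by
  have h := (ht.commute_initProj_star n 1).eq
  have h1 : t * star t * t = t := by simpa using ht 1
  have h2 : t * initProj t (n + 1) = initProj (star t) 1 * initProj t n * t := by
    simp [initProj, pow_succ, mul_assoc]
  rw [h2, ← h, mul_assoc]
  congr 1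
  simpa [initProj] using h1

/-- The adjoint of the previous relation for `star t`: applying `t` raises the level of the opposite
chain by one. -/
theorem IsPowerPartialIsom.initProj_star_succ_mul (ht : IsPowerPartialIsom t) (n : ℕ) :
    initProj (star t) (n + 1) * t = t * initProj (star t) n := by
  have h := congrArg star (ht.star_mem.mul_initProj_succ n)
  simpa [star_initProj] using h

end Algebra

/-! ### Levels of commuting chains of projections -/

section Hilbert

variable {H : Type*} [NormedAddCommGroup H] [InnerProductSpace ℂ H]

open Classical in
/-- The vectors that stay in the ranges of the projections `E n` exactly for `n ≤ a`. -/
def level (E : ℕ → H →L[ℂ] H) (a : ℕ∞) : Submodule ℂ H where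
  carrier := {x | ∀ n : ℕ, E n x = if (n : ℕ∞) ≤ a then x else 0}
  add_mem' {x y} hx hy n := by
    rw [map_add, hx n, hy n]
    split_ifs <;> simp
  zero_mem' n := by simp
  smul_mem' c x hx n := by
    rw [map_smul, hx n]
    split_ifs <;> simp

open Classical in
theorem mem_level {E : ℕ → H →L[ℂ] H} {a : ℕ∞} {x : H} :
    x ∈ level E a ↔ ∀ n : ℕ, E n x = if (n : ℕ∞) ≤ a then x else 0 := Iff.rfl

theorem isClosed_level (E : ℕ → H →L[ℂ] H) (a : ℕ∞) : IsClosed (level E a : Set H) := by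
  classical
  have : (level E a : Set H) = ⋂ n : ℕ, {x | E n x = if (n : ℕ∞) ≤ a then x else 0} := by
    ext x
    simp [mem_level]
  rw [this]
  refine isClosed_iInter fun n => isClosed_eq (E n).continuous ?_
  split_ifs
  · exact continuous_id
  · exact continuous_const

theorem mem_level_of_commute {E : ℕ → H →L[ℂ] H} {A : H →L[ℂ] H} (h : ∀ n, Commute (E n) A)
    {a : ℕ∞} {x : H} (hx : x ∈ level E a) : A x ∈ level E a := by
  intro n
  have := congrArg (fun B : H →L[ℂ] H => B x) (h n).eq
  simp only [mul_apply_eq_comp] at this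
  rw [this, hx n]
  split_ifs <;> simp

/-- The joint levels of a family of chains of projections. -/
def jointLevel {ι : Type*} (E : ι → ℕ → H →L[ℂ] H) (α : ι → ℕ∞) : Submodule ℂ H :=
  ⨅ j, level (E j) (α j)

theorem mem_jointLevel {ι : Type*} {E : ι → ℕ → H →L[ℂ] H} {α : ι → ℕ∞} {x : H} : x ∈ jointLevel E α ↔ ∀ j, x ∈ level (E j) (α j) := by
  simp [jointLevel]

theorem isClosed_jointLevel {ι : Type*} {E : ι → ℕ → H →L[ℂ] H} {α : ι → ℕ∞} : IsClosed (jointLevel E α : Set H) := by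
  rw [jointLevel, Submodule.coe_iInf]
  exact isClosed_iInter fun j => isClosed_level _ _

variable [CompleteSpace H]

/-- On the complement of the kernel `V` preserves inner products, so `star V * V` acts there as the
identity; on the kernel both sides vanish. -/
theorem IsPartialIsometry.mul_star_mul {V : H →L[ℂ] H} (hV : IsPartialIsometry V) :
    V * star V * V = V := by
  set K := LinearMap.ker (V : H →ₗ[ℂ] H) with hK
  have : CompleteSpace K := V.isClosed_ker.completeSpace_coe
  let W : Kᗮ →ₗᵢ[ℂ] H :=
    { toLinearMap := (V : H →ₗ[ℂ] H).comp Kᗮ.subtype, norm_map' := fun x => hV x x.2 }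
  have hW : ∀ x y : H, x ∈ Kᗮ → y ∈ Kᗮ → ⟪V x, V y⟫_ℂ = ⟪x, y⟫_ℂ := fun x y hx hy =>
    W.inner_map_map ⟨x, hx⟩ ⟨y, hy⟩
  have hker : ∀ x ∈ K, V x = 0 := fun x hx => hx
  have key : ∀ x ∈ Kᗮ, star V (V x) = x := by
    intro x hx
    refine ext_inner_right ℂ fun y => ?_
    rw [ContinuousLinearMap.star_eq_adjoint, ContinuousLinearMap.adjoint_inner_left]
    obtain ⟨y1, hy1, y2, hy2, rfl⟩ := K.exists_add_mem_mem_orthogonal y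
    rw [map_add, hker y1 hy1, zero_add, hW x y2 hx hy2, inner_add_right,
      K.inner_left_of_mem_orthogonal hy1 hx, zero_add]
  ext x
  obtain ⟨x1, hx1, x2, hx2, rfl⟩ := K.exists_add_mem_mem_orthogonal x
  change V (star V (V (x1 + x2))) = V (x1 + x2)
  rw [map_add, hker x1 hx1, zero_add, key x2 hx2]

theorem IsPowerPartialIsometry.isPowerPartialIsom {T : H →L[ℂ] H} (hT : IsPowerPartialIsometry T) :
    IsPowerPartialIsom T := fun n => (hT n).mul_star_mul

/-- A decreasing sequence of orthogonal projections that starts at the identity. -/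
structure IsProjChain (E : ℕ → H →L[ℂ] H) : Prop where
  zero : E 0 = 1
  star_eq : ∀ n, star (E n) = E n
  mul_eq : ∀ m n, m ≤ n → E n * E m = E n
  mul_eq' : ∀ m n, m ≤ n → E m * E n = E n

theorem IsPowerPartialIsom.isProjChain {T : H →L[ℂ] H} (hT : IsPowerPartialIsom T) :
    IsProjChain (initProj T) where
  zero := initProj_zero
  star_eq := star_initProj
  mul_eq _ _ h := hT.initProj_mul h
  mul_eq' _ _ h := hT.initProj_mul' h

/-- For `a < b` the projection `E (a + 1)` kills the vector of level `a` and fixes the one of level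
`b`. -/
theorem IsProjChain.inner_eq_zero {E : ℕ → H →L[ℂ] H} (hE : IsProjChain E) {a b : ℕ∞}
    (hab : a ≠ b) {x y : H} (hx : x ∈ level E a) (hy : y ∈ level E b) : ⟪x, y⟫_ℂ = 0 := by
  have main : ∀ {a b : ℕ∞} {x y : H}, a < b → x ∈ level E a → y ∈ level E b → ⟪x, y⟫_ℂ = 0 := by
    intro a b x y hab hx hy
    lift a to ℕ using hab.ne_top
    have h1 := hx (a + 1)
    have h2 := hy (a + 1)
    rw [if_neg (by exact_mod_cast Nat.not_succ_le_self a)] at h1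
    rw [if_pos (by push_cast; exact Order.add_one_le_of_lt hab)] at h2
    rw [← h2, ← hE.star_eq, ContinuousLinearMap.star_eq_adjoint,
      ContinuousLinearMap.adjoint_inner_right, h1, inner_zero_left]
  rcases hab.lt_or_gt with h | h
  · exact main h hx hy
  · rw [inner_eq_zero_symm]
    exact main h hy hx

/-- If some difference `E n z - E (n + 1) z` is nonzero, it has level `n` and its inner product with
`z` is its norm squared; otherwise every `E n` fixes `z`, which has level `⊤`. The invariant
subspace `K` allows the other chains to be treated one after another. -/
theorem IsProjChain.exists_mem_level {E : ℕ → H →L[ℂ] H} (hE : IsProjChain E) {K : Submodule ℂ H}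
    (hK : ∀ n, ∀ x ∈ K, E n x ∈ K) {z : H} (hz : z ∈ K) (hz0 : z ≠ 0) :
    ∃ a, ∃ w ∈ level E a ⊓ K, ⟪w, z⟫_ℂ ≠ 0 := by
  classical
  by_cases h : ∃ n, E n z - E (n + 1) z ≠ 0
  · obtain ⟨n, hn⟩ := h
    have hmem : E n z - E (n + 1) z ∈ level E n := by
      intro k
      rw [map_sub, ← mul_apply_eq_comp, ← mul_apply_eq_comp]
      split_ifs with hk
      · have hk' : k ≤ n := by exact_mod_cast hk
        rw [hE.mul_eq' k n hk', hE.mul_eq' k (n + 1) (by omega)]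
      · have hk' : n + 1 ≤ k := by
          have : ¬ k ≤ n := by exact_mod_cast hk
          omega
        rw [hE.mul_eq n k (by omega), hE.mul_eq (n + 1) k hk', sub_self]
    refine ⟨n, _, ⟨hmem, K.sub_mem (hK n z hz) (hK (n + 1) z hz)⟩, ?_⟩
    have hproj : E n (E n z - E (n + 1) z) - E (n + 1) (E n z - E (n + 1) z)
        = E n z - E (n + 1) z := by
      rw [hmem n, hmem (n + 1), if_pos le_rfl, if_neg (by exact_mod_cast Nat.not_succ_le_self n),
        sub_zero]
    have hsym : ∀ k x y, ⟪E k x, y⟫_ℂ = ⟪x, E k y⟫_ℂ := fun k x y => by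
      conv_lhs => rw [← hE.star_eq, ContinuousLinearMap.star_eq_adjoint,
        ContinuousLinearMap.adjoint_inner_left]
    intro h0
    apply hn
    rw [← inner_self_eq_zero (𝕜 := ℂ)]
    conv_lhs => rw [inner_sub_right, ← hsym, ← hsym, ← inner_sub_left, hproj]
    exact h0
  · push Not at h
    have hall : ∀ n, E n z = z := by
      intro n
      induction n with
      | zero => simp [hE.zero]
      | succ n ih => rw [← sub_eq_zero.1 (h n), ih]
    exact ⟨⊤, z, ⟨fun n => by simp [hall n], hz⟩, by simpa using hz0⟩

section Joint

variable {ι : Type*} {E : ι → ℕ → H →L[ℂ] H} {α β : ι → ℕ∞}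

theorem inner_jointLevel_eq_zero (hE : ∀ j, IsProjChain (E j)) (h : α ≠ β) {x y : H}
    (hx : x ∈ jointLevel E α) (hy : y ∈ jointLevel E β) : ⟪x, y⟫_ℂ = 0 := by
  obtain ⟨j, hj⟩ := Function.ne_iff.1 h
  exact (hE j).inner_eq_zero hj (mem_jointLevel.1 hx j) (mem_jointLevel.1 hy j)

/-- The joint levels of commuting chains of projections span a dense subspace. -/
theorem eq_zero_of_forall_jointLevel [Finite ι] (hE : ∀ j, IsProjChain (E j))
    (hcomm : ∀ j j', j ≠ j' → ∀ m n, Commute (E j m) (E j' n)) {y : H}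
    (hy : ∀ α, ∀ x ∈ jointLevel E α, ⟪x, y⟫_ℂ = 0) : y = 0 := by
  classical
  by_contra hy0
  -- The levels of the chains in `s` are fixed one chain at a time, keeping a vector not orthogonal
  -- to `y`.
  have key : ∀ s : Finset ι, ∃ α : ι → ℕ∞, ∃ x, (∀ j ∈ s, x ∈ level (E j) (α j)) ∧
      ⟪x, y⟫_ℂ ≠ 0 := by
    intro s
    induction s using Finset.induction_on with
    | empty => exact ⟨0, y, by simp, by simpa using hy0⟩
    | insert j s hj ih =>
      obtain ⟨α, x, hx, hxy⟩ := ih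
      let K : Submodule ℂ H := ⨅ i ∈ s, level (E i) (α i)
      have hmem : ∀ z, z ∈ K ↔ ∀ i ∈ s, z ∈ level (E i) (α i) := fun z => by
        simp [K, Submodule.mem_iInf]
      have hKc : IsClosed (K : Set H) := by
        have : (K : Set H) = ⋂ i ∈ s, (level (E i) (α i) : Set H) := by simp [K]
        rw [this]
        exact isClosed_biInter fun i _ => isClosed_level _ _
      have : CompleteSpace K := hKc.completeSpace_coe
      -- The component `z` of `y` in `K` is nonzero because `x` lies in `K` and is not orthogonal to
      -- `y`. As `E j` preserves `K`, a vector of some level for `j` can be found inside `K`, so the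
      -- levels already fixed survive.
      obtain ⟨z, hz, v, hv, rfl⟩ := K.exists_add_mem_mem_orthogonal y
      have hz0 : z ≠ 0 := by
        rintro rfl
        exact hxy (by simpa using K.inner_right_of_mem_orthogonal ((hmem x).2 hx) hv)
      obtain ⟨a, w, ⟨hwa, hwK⟩, hwz⟩ := (hE j).exists_mem_level (K := K) (fun n x hx => by
        rw [hmem] at hx ⊢
        exact fun i hi => mem_level_of_commute
          (fun k => hcomm i j (fun h => hj (h ▸ hi)) k n) (hx i hi)) hz hz0
      refine ⟨Function.update α j a, w, fun i hi => ?_, ?_⟩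
      · rcases Finset.mem_insert.1 hi with rfl | hi
        · simpa using hwa
        · rw [Function.update_of_ne (ne_of_mem_of_not_mem hi hj)]
          exact (hmem w).1 hwK i hi
      · rwa [inner_add_right, K.inner_right_of_mem_orthogonal hwK hv, add_zero]
  cases nonempty_fintype ι
  obtain ⟨α, x, hx, hxy⟩ := key Finset.univ
  exact hxy (hy α x (mem_jointLevel.2 fun j => hx j (Finset.mem_univ j)))

end Joint

end Hilbert

/-! ### Raising and lowering the joint levels -/

section Step

variable {ι : Type*} {H : Type*} [NormedAddCommGroup H] [InnerProductSpace ℂ H] [CompleteSpace H]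

/-- The operators `T m` and their adjoints, as a single family. -/
noncomputable def signedOp (T : ι → H →L[ℂ] H) (j : ι × Bool) : H →L[ℂ] H :=
  if j.2 then star (T j.1) else T j.1

theorem star_signedOp (T : ι → H →L[ℂ] H) (m : ι) (d : Bool) :
    star (signedOp T (m, d)) = signedOp T (m, !d) := by
  cases d <;> simp [signedOp]

/-- The family of all chains of initial and final projections of the powers of the `T m`. -/
noncomputable def signedChain (T : ι → H →L[ℂ] H) (j : ι × Bool) : ℕ → H →L[ℂ] H :=
  initProj (signedOp T j)

variable {T : ι → H →L[ℂ] H}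

theorem isPowerPartialIsom_signedOp (hT : ∀ m, IsPowerPartialIsometry (T m)) (j : ι × Bool) :
    IsPowerPartialIsom (signedOp T j) := by
  unfold signedOp
  split_ifs
  · exact (hT j.1).isPowerPartialIsom.star_mem
  · exact (hT j.1).isPowerPartialIsom

theorem commute_signedOp (hcomm : StarCommuting T) {m n : ι} (hmn : m ≠ n) (d e : Bool) :
    Commute (signedOp T (m, d)) (signedOp T (n, e)) := by
  have h1 : Commute (T m) (T n) := hcomm.1 m n
  have h2 : Commute (star (T m)) (T n) := hcomm.2 m n hmn
  have h3 : Commute (star (T n)) (T m) := hcomm.2 n m hmn.symm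
  cases d <;> cases e <;> simp only [signedOp, if_true, if_false, Bool.false_eq_true]
  · exact h1
  · exact h3.symm
  · exact h2
  · exact h1.star_star

theorem isProjChain_signedChain (hT : ∀ m, IsPowerPartialIsometry (T m)) (j : ι × Bool) :
    IsProjChain (signedChain T j) :=
  (isPowerPartialIsom_signedOp hT j).isProjChain

theorem commute_signedChain_signedOp (hcomm : StarCommuting T) {m n : ι} (hmn : m ≠ n)
    (d e : Bool) (k : ℕ) : Commute (signedChain T (m, d) k) (signedOp T (n, e)) :=
  commute_initProj (commute_signedOp hcomm hmn d e)
    (by rw [star_signedOp]; exact commute_signedOp hcomm hmn _ e) k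

/-- For a single operator the two chains are opposite and Halmos–Wallen applies; for different
operators star-commutation suffices. -/
theorem commute_signedChain (hT : ∀ m, IsPowerPartialIsometry (T m)) (hcomm : StarCommuting T)
    (j j' : ι × Bool) (h : j ≠ j') (k l : ℕ) :
    Commute (signedChain T j k) (signedChain T j' l) := by
  obtain ⟨m, d⟩ := j
  obtain ⟨n, e⟩ := j'
  by_cases hmn : m = n
  · subst hmn
    have he : e = !d := by
      cases d <;> cases e <;> simp_all
    subst he
    have := (isPowerPartialIsom_signedOp hT (m, d)).commute_initProj_star k l
    rwa [star_signedOp] at this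
  · refine (commute_initProj (commute_signedChain_signedOp hcomm hmn d e k).symm ?_ l).symm
    rw [star_signedOp]
    exact (commute_signedChain_signedOp hcomm hmn d _ k).symm

open Classical in
/-- The effect of `signedOp T j` on the joint levels. -/
noncomputable def step (α : ι × Bool → ℕ∞) (m : ι) (d : Bool) : ι × Bool → ℕ∞ := fun j =>
  if j.1 = m then if j.2 = d then α j - 1 else α j + 1 else α j

variable {α : ι × Bool → ℕ∞} {m : ι} {d : Bool} {x : H}

theorem signedOp_eq_zero (hT : ∀ m, IsPowerPartialIsometry (T m)) (h : α (m, d) = 0)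
    (hx : x ∈ jointLevel (signedChain T) α) : signedOp T (m, d) x = 0 := by
  have h1 := mem_jointLevel.1 hx (m, d) 1
  rw [h, if_neg (by simp)] at h1
  have h2 := isPowerPartialIsom_signedOp hT (m, d) 1
  have h3 : signedOp T (m, d) * signedChain T (m, d) 1 = signedOp T (m, d) := by
    simpa [signedChain, initProj, mul_assoc] using h2
  rw [← h3, mul_apply_eq_comp, h1, map_zero]

theorem signedOp_not_signedOp (h : α (m, d) ≠ 0)
    (hx : x ∈ jointLevel (signedChain T) α) :
    signedOp T (m, !d) (signedOp T (m, d) x) = x := by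
  have h1 := mem_jointLevel.1 hx (m, d) 1
  rw [if_pos (by simpa using Order.one_le_iff_ne_zero.2 h)] at h1
  simpa [signedChain, initProj, star_signedOp, mul_apply_eq_comp] using h1

theorem norm_signedOp (h : α (m, d) ≠ 0) (hx : x ∈ jointLevel (signedChain T) α) :
    ‖signedOp T (m, d) x‖ = ‖x‖ := by
  rw [← sq_eq_sq₀ (norm_nonneg _) (norm_nonneg _), ← Complex.ofReal_inj,
    ← HTensor.inner_self_eq, ← HTensor.inner_self_eq, ← ContinuousLinearMap.adjoint_inner_left,
    ← ContinuousLinearMap.star_eq_adjoint, star_signedOp, signedOp_not_signedOp h hx]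

/-- The chain of the operator itself shifts down by `mul_initProj_succ`, the opposite chain shifts
up by `initProj_star_succ_mul`, and all other chains commute with the operator. -/
theorem signedOp_mem (hT : ∀ m, IsPowerPartialIsometry (T m)) (hcomm : StarCommuting T)
    (h : α (m, d) ≠ 0) (hx : x ∈ jointLevel (signedChain T) α) :
    signedOp T (m, d) x ∈ jointLevel (signedChain T) (step α m d) := by
  have hP := isPowerPartialIsom_signedOp hT (m, d)
  rw [mem_jointLevel] at hx ⊢
  rintro ⟨n, e⟩
  by_cases hn : n = m
  · subst hn
    by_cases he : e = d
    · subst he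
      intro k
      have h1 := congrArg (fun B : H →L[ℂ] H => B x) (hP.mul_initProj_succ k)
      simp only [mul_apply_eq_comp] at h1
      have h2 := hx (n, e) (k + 1)
      simp only [signedChain] at h1 h2 ⊢
      rw [← h1, h2]
      -- With truncated subtraction this fails at `k = 0` for level `0`, which `h` excludes.
      have : ((k + 1 : ℕ) : ℕ∞) ≤ α (n, e) ↔ (k : ℕ∞) ≤ α (n, e) - 1 := by
        generalize α (n, e) = a at h
        cases a with
        | top => simp
        | coe a =>
          have : a ≠ 0 := by exact_mod_cast h
          norm_cast
          omega
      simp only [step, if_true, this]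
      split_ifs <;> simp
    · have he' : e = !d := by
        cases d <;> cases e <;> simp_all
      subst he'
      intro k
      cases k with
      | zero => simp [signedChain, initProj_zero]
      | succ k =>
        have h1 := congrArg (fun B : H →L[ℂ] H => B x) (hP.initProj_star_succ_mul k)
        simp only [mul_apply_eq_comp, star_signedOp] at h1
        have h2 := hx (n, !d) k
        simp only [signedChain] at h1 h2 ⊢
        rw [h1, h2]
        have : ((k + 1 : ℕ) : ℕ∞) ≤ α (n, !d) + 1 ↔ (k : ℕ∞) ≤ α (n, !d) := by
          generalize α (n, !d) = a
          cases a with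
          | top => simp
          | coe a =>
            norm_cast
            omega
        simp only [step, if_true, he, if_false, this]
        split_ifs <;> simp
  · simp only [step, if_neg hn]
    exact mem_level_of_commute (fun k => commute_signedChain_signedOp hcomm hn e d k) (hx (n, e))

end Step

/-! ### Positions along the chains attached to the labels -/

/-- The length of the orbit of a cyclic vector, minus one. -/
def Label.len : Label → ℕ∞
  | .trunc p => (PNat.natPred p : ℕ)
  | _ => ⊤

/-- How often a cyclic vector can be moved backwards. -/
def Label.base : Label → ℕ∞
  | .u => ⊤
  | _ => 0

/-- Whether the adjoint moves a cyclic vector forwards. -/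
def Label.dir : Label → Bool
  | .b => true
  | _ => false

/-- The pair of lifetimes of the vector number `k` in the orbit attached to a label. -/
noncomputable def Label.pos (l : Label) (k : ℕ) (d : Bool) : ℕ∞ :=
  if d = l.dir then l.len - k else l.base + k

/-- The numbers of the vectors in the orbit attached to a label. -/
def Label.Valid (l : Label) (k : ℕ) : Prop := k ≤ l.len ∧ (l = .u → k = 0)

/-- Which of the two levels are infinite determines the type of label. A finite level opposite to
the direction is `k`; for a truncated shift the two levels add up to `p - 1`, since validity keeps
the subtraction exact. For `u` the position is invisible, hence the convention `k = 0`. -/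
theorem Label.pos_injective {l l' : Label} {k k' : ℕ} (hk : l.Valid k) (hk' : l'.Valid k')
    (h : l.pos k = l'.pos k') : l = l' ∧ k = k' := by
  have h0 := congrFun h false
  have h1 := congrFun h true
  cases l with
  | trunc p =>
    cases l' with
    | trunc q =>
      simp only [Label.pos, Label.dir, Label.len, Label.base, if_true, Bool.true_eq_false, if_false,
        zero_add, Label.Valid] at h0 h1 hk hk'
      have hkk : k = k' := by exact_mod_cast h1
      subst hkk
      have h2 : k ≤ p.natPred := by exact_mod_cast hk.1
      have h3 : k ≤ q.natPred := by exact_mod_cast hk'.1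
      have h4 : p.natPred - k = q.natPred - k := by exact_mod_cast h0
      have h5 : p.natPred = q.natPred := by omega
      exact ⟨by rw [PNat.natPred_injective h5], rfl⟩
    | _ =>
      simp [Label.pos, Label.dir, Label.len, Label.base] at h0 h1
      try exact ENat.natCast_ne_top _ h0
  | _ =>
    cases l' <;>
      simp [Label.pos, Label.dir, Label.len, Label.base, Label.Valid] at h0 h1 hk hk' ⊢ <;>
      first
      | exact h0
      | exact h1
      | omega
      | exact absurd h0.symm (ENat.natCast_ne_top _)

theorem Label.exists_pos_eq (f : Bool → ℕ∞) : ∃ l : Label, ∃ k, l.Valid k ∧ l.pos k = f := by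
  have key : ∀ a b, ∃ l : Label, ∃ k, l.Valid k ∧ l.pos k false = a ∧ l.pos k true = b := by
    intro a b
    cases a with
    | top =>
      cases b with
      | top => exact ⟨.u, 0, by simp [Label.Valid, Label.pos, Label.dir, Label.len, Label.base]⟩
      | coe b => exact ⟨.s, b, by simp [Label.Valid, Label.pos, Label.dir, Label.len, Label.base]⟩
    | coe a =>
      cases b with
      | top => exact ⟨.b, a, by simp [Label.Valid, Label.pos, Label.dir, Label.len, Label.base]⟩
      | coe b =>
        -- The vector can be moved `b` steps back and `a` steps forward, so its orbit has `a + b +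
        -- 1` members.
        refine ⟨.trunc (a + b).succPNat, b, ?_⟩
        simp only [Label.Valid, Label.pos, Label.dir, Label.len, Label.base, if_true,
          Nat.natPred_succPNat]
        norm_cast
        simp
  obtain ⟨l, k, h, h0, h1⟩ := key (f false) (f true)
  exact ⟨l, k, h, funext fun d => by cases d <;> assumption⟩

theorem Label.pos_dir (l : Label) (k : ℕ) : l.pos k l.dir = l.len - k := if_pos rfl

theorem Label.pos_not_dir (l : Label) (k : ℕ) : l.pos k (!l.dir) = l.base + k := by
  simp [Label.pos]

theorem Label.pos_u (k : ℕ) (d : Bool) : Label.u.pos k d = ⊤ := by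
  simp [Label.pos, Label.len, Label.base]

section Orbit

variable {ι : Type*} {H : Type*} [NormedAddCommGroup H] [InnerProductSpace ℂ H] [CompleteSpace H]

/-- The levels of the vector number `k` in the orbit attached to a family of labels. -/
noncomputable def orbitPos (i : ι → Label) (k : ι → ℕ) (j : ι × Bool) : ℕ∞ :=
  (i j.1).pos (k j.1) j.2

theorem orbitPos_injective {i i' : ι → Label} {k k' : ι → ℕ} (hk : ∀ m, (i m).Valid (k m))
    (hk' : ∀ m, (i' m).Valid (k' m)) (h : orbitPos i k = orbitPos i' k') : i = i' ∧ k = k' := by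
  have key := fun m => Label.pos_injective (hk m) (hk' m) (funext fun d => congrFun h (m, d))
  exact ⟨funext fun m => (key m).1, funext fun m => (key m).2⟩

theorem exists_orbitPos_eq (α : ι × Bool → ℕ∞) :
    ∃ i : ι → Label, ∃ k : ι → ℕ, (∀ m, (i m).Valid (k m)) ∧ orbitPos i k = α := by
  choose i k h h' using fun m => Label.exists_pos_eq fun d => α (m, d)
  exact ⟨i, k, h, funext fun j => congrFun (h' j.1) j.2⟩

variable [DecidableEq ι] (i : ι → Label) (k : ι → ℕ) (m : ι)

theorem step_orbitPos_dir :
    step (orbitPos i k) m (i m).dir = orbitPos i (k + Pi.single m 1) := by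
  funext ⟨n, e⟩
  by_cases hn : n = m
  · subst hn
    by_cases he : e = (i n).dir
    · subst he
      simp [step, orbitPos, Label.pos_dir, tsub_add_eq_tsub_tsub]
    · have he' : e = !(i n).dir := by
        generalize (i n).dir = d at he
        cases d <;> cases e <;> simp_all
      subst he'
      simp [step, orbitPos, Label.pos_not_dir, add_assoc]
  · simp [step, orbitPos, hn]

/-- The bound `hk` is what makes `len - (k m + 1) + 1 = len - k m` under truncated subtraction. -/
theorem step_orbitPos_not_dir (hm : i m ≠ .u) (hk : ((k m + 1 : ℕ) : ℕ∞) ≤ (i m).len) :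
    step (orbitPos i (k + Pi.single m 1)) m (!(i m).dir) = orbitPos i k := by
  funext ⟨n, e⟩
  by_cases hn : n = m
  · subst hn
    by_cases he : e = (i n).dir
    · subst he
      simp only [step, orbitPos, Label.pos_dir, if_true, Pi.add_apply, Pi.single_eq_same]
      rw [if_neg (by simp)]
      generalize (i n).len = a at hk
      cases a with
      | top => simp
      | coe a =>
        norm_cast at hk ⊢
        omega
    · have he' : e = !(i n).dir := by
        generalize (i n).dir = d at he
        cases d <;> cases e <;> simp_all
      subst he'
      simp only [step, orbitPos, Label.pos_not_dir, if_true, Pi.add_apply, Pi.single_eq_same]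
      generalize (i n).base = a
      cases a with
      | top => simp
      | coe a => norm_cast
  · simp [step, orbitPos, hn]

theorem step_orbitPos_u (hm : i m = .u) (d : Bool) :
    step (orbitPos i k) m d = orbitPos i k := by
  funext ⟨n, e⟩
  by_cases hn : n = m
  · subst hn
    simp [step, orbitPos, hm, Label.pos_u]
  · simp [step, hn]

end Orbit

/-! ### Words in commuting operators -/

/-- Induction on functions `ι → ℕ`, one step at a time. -/
theorem pi_nat_induction {ι : Type*} [Fintype ι] [DecidableEq ι] {P : (ι → ℕ) → Prop} (h0 : P 0)
    (h1 : ∀ k m, P k → P (k + Pi.single m 1)) (k : ι → ℕ) : P k := by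
  induction h : ∑ m, k m generalizing k with
  | zero =>
    have : k = 0 := by
      funext m
      exact (Finset.sum_eq_zero_iff.1 h) m (Finset.mem_univ m)
    rwa [this]
  | succ n ih =>
    obtain ⟨m, hm⟩ : ∃ m, k m ≠ 0 := by
      by_contra! hk
      simp [hk] at h
    have hk : k = (k - Pi.single m 1) + Pi.single m 1 := by
      funext n
      by_cases hn : n = m
      · subst hn
        simp
        omega
      · simp [hn]
    rw [hk]
    refine h1 _ _ (ih _ ?_)
    rw [hk] at h
    simp only [Pi.add_apply, Finset.sum_add_distrib, Finset.sum_pi_single', Finset.mem_univ,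
      if_true] at h
    simpa using h

section Word

variable {ι : Type*} [Fintype ι] {R : Type*} [Monoid R]

omit [Fintype ι] in
theorem pairwise_commute_powersHom {A : ι → R} (hA : Pairwise fun m n => Commute (A m) (A n)) :
    Pairwise fun m n => ∀ x y : Multiplicative ℕ,
      Commute (powersHom R (A m) x) (powersHom R (A n) y) :=
  fun _ _ h x y => ((hA h).pow_left x.toAdd).pow_right y.toAdd

/-- The product of the powers `A m ^ k m` of commuting elements. -/
noncomputable def word (A : ι → R) (hA : Pairwise fun m n => Commute (A m) (A n)) (k : ι → ℕ) : R :=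
  MonoidHom.noncommPiCoprod (fun m => powersHom R (A m)) (pairwise_commute_powersHom hA)
    fun m => Multiplicative.ofAdd (k m)

variable (A : ι → R) (hA : Pairwise fun m n => Commute (A m) (A n))

theorem word_zero : word A hA 0 = 1 := map_one _

theorem word_add_single [DecidableEq ι] (k : ι → ℕ) (m : ι) :
    word A hA (k + Pi.single m 1) = A m * word A hA k := by
  have h : (fun n => Multiplicative.ofAdd ((k + Pi.single m 1 : ι → ℕ) n))
      = Pi.mulSingle m (Multiplicative.ofAdd 1) * fun n => Multiplicative.ofAdd (k n) := by
    funext n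
    by_cases hn : n = m
    · subst hn
      simp [mul_comm]
    · simp [hn]
  rw [word, h, map_mul, MonoidHom.noncommPiCoprod_mulSingle, powersHom_apply]
  simp [word]

theorem commute_word {B : R} (hB : ∀ m, Commute B (A m)) (k : ι → ℕ) :
    Commute B (word A hA k) := by
  classical
  induction k using pi_nat_induction with
  | h0 =>
    rw [word_zero]
    exact Commute.one_right B
  | h1 k m ih =>
    rw [word_add_single]
    exact (hB m).mul_right ih

end Word

/-! ### Moving cyclic vectors along their orbits -/

section OrbitMap

variable {ι : Type*} [Fintype ι] [DecidableEq ι] {H : Type*} [NormedAddCommGroup H]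
  [InnerProductSpace ℂ H] [CompleteSpace H] {T : ι → H →L[ℂ] H}

/-- The product of the operators that move a cyclic vector to the vector number `k` of its orbit. -/
noncomputable def orbitWord (hcomm : StarCommuting T) (i : ι → Label) (k : ι → ℕ) : H →L[ℂ] H :=
  word (fun m => signedOp T (m, (i m).dir)) (fun _ _ h => commute_signedOp hcomm h _ _) k

/-- The subspace of the vectors number `k` in the orbits attached to a family of labels. -/
noncomputable def orbitSpace (T : ι → H →L[ℂ] H) (i : ι → Label) (k : ι → ℕ) : Submodule ℂ H :=
  jointLevel (signedChain T) (orbitPos i k)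

variable (hT : ∀ m, IsPowerPartialIsometry (T m)) (hcomm : StarCommuting T) (i : ι → Label)

include hT in
-- Each further letter is isometric because the forward level is still nonzero. It is onto because
-- the opposite operator leads back from the new position and is undone by the letter.
theorem orbitWord_spec (k : ι → ℕ) (hk : ∀ m, (i m).Valid (k m)) :
    (∀ x ∈ orbitSpace T i 0, orbitWord hcomm i k x ∈ orbitSpace T i k ∧
      ‖orbitWord hcomm i k x‖ = ‖x‖) ∧
    ∀ y ∈ orbitSpace T i k, ∃ x ∈ orbitSpace T i 0, orbitWord hcomm i k x = y := by
  induction k using pi_nat_induction with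
  | h0 =>
    have hw : orbitWord hcomm i 0 = 1 := word_zero _ _
    rw [hw]
    simp
  | h1 k m ih =>
    have hkm : ((k m + 1 : ℕ) : ℕ∞) ≤ (i m).len := by simpa using (hk m).1
    have hu : i m ≠ .u := fun h => by simpa using (hk m).2 h
    obtain ⟨ih1, ih2⟩ := ih fun n => by
      by_cases hn : n = m
      · subst hn
        exact ⟨le_trans (by exact_mod_cast Nat.le_succ _) hkm, fun h => absurd h hu⟩
      · simpa [hn] using hk n
    have hw : orbitWord hcomm i (k + Pi.single m 1)
        = signedOp T (m, (i m).dir) * orbitWord hcomm i k := word_add_single _ _ _ _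
    have hpos : orbitPos i k (m, (i m).dir) ≠ 0 := by
      simp only [orbitPos, Label.pos_dir]
      intro h
      rw [tsub_eq_zero_iff_le] at h
      have := hkm.trans h
      norm_cast at this
      omega
    have hpos' : orbitPos i (k + Pi.single m 1) (m, !(i m).dir) ≠ 0 := by
      simp [orbitPos, Label.pos_not_dir]
    refine ⟨fun x hx => ?_, fun y hy => ?_⟩
    · obtain ⟨h1, h2⟩ := ih1 x hx
      rw [hw, mul_apply_eq_comp, norm_signedOp hpos h1, h2]
      refine ⟨?_, rfl⟩
      have := signedOp_mem hT hcomm hpos h1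
      rwa [step_orbitPos_dir] at this
    · have h1 := signedOp_mem hT hcomm hpos' hy
      rw [step_orbitPos_not_dir i k m hu hkm] at h1
      obtain ⟨x, hx, hxy⟩ := ih2 _ h1
      refine ⟨x, hx, ?_⟩
      have h2 := signedOp_not_signedOp hpos' hy
      rw [hw, mul_apply_eq_comp, hxy]
      simpa using h2

end OrbitMap

end StarPPI

namespace HTensor

/-! ### Elementary tensors in Hilbert space tensor products -/

section Pi

variable {ι : Type*} {E : ι → Type*} [∀ i, NormedAddCommGroup (E i)]
  [∀ i, InnerProductSpace ℂ (E i)] [Fintype ι]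

theorem Alg.norm_tprod (x : ∀ i, E i) : ‖Alg.tprod E x‖ = ∏ i, ‖x i‖ := by
  rw [← sq_eq_sq₀ (norm_nonneg _) (by positivity), ← Complex.ofReal_inj, ← inner_self_eq,
    Alg.inner_tprod, ← Finset.prod_pow]
  simp

/-- The elementary tensors in the Hilbert space tensor product. -/
noncomputable def PiHilbert.pure (x : ∀ i, E i) : PiHilbert E := (Alg.tprod E x : Alg E)

theorem PiHilbert.inner_pure (x y : ∀ i, E i) :
    ⟪PiHilbert.pure x, PiHilbert.pure y⟫_ℂ = ∏ i, ⟪x i, y i⟫_ℂ := by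
  rw [PiHilbert.pure, PiHilbert.pure, UniformSpace.Completion.inner_coe, Alg.inner_tprod]

theorem PiHilbert.norm_pure (x : ∀ i, E i) : ‖PiHilbert.pure x‖ = ∏ i, ‖x i‖ := by
  rw [PiHilbert.pure, UniformSpace.Completion.norm_coe, Alg.norm_tprod]

theorem PiHilbert.map_pure (A : ∀ i, E i →L[ℂ] E i) (x : ∀ i, E i) :
    PiHilbert.map A (PiHilbert.pure x) = PiHilbert.pure fun i => A i (x i) := by
  rw [PiHilbert.map, PiHilbert.pure, ContinuousLinearMap.completion_apply_coe]
  exact congrArg _ (Alg.mapLin_tprod _ x)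

theorem PiHilbert.pure_eq_zero {x : ∀ i, E i} {i : ι} (h : x i = 0) : PiHilbert.pure x = 0 := by
  rw [← norm_eq_zero, PiHilbert.norm_pure]
  exact Finset.prod_eq_zero (Finset.mem_univ i) (by simp [h])

/-- Elementary tensors as a continuous linear function of one of the slots. -/
noncomputable def PiHilbert.pureSlot [DecidableEq ι] (x : ∀ i, E i) (i : ι) :
    E i →L[ℂ] PiHilbert E :=
  UniformSpace.Completion.toComplL.comp
    (((Alg.tprod E).toLinearMap x i).mkContinuous (∏ j ∈ Finset.univ.erase i, ‖x j‖) fun y => by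
      rw [MultilinearMap.toLinearMap_apply, Alg.norm_tprod,
        ← Finset.prod_erase_mul _ _ (Finset.mem_univ i), Function.update_self]
      refine le_of_eq (congrArg (· * ‖y‖) (Finset.prod_congr rfl fun j hj => ?_))
      rw [Function.update_of_ne (Finset.ne_of_mem_erase hj)])

theorem PiHilbert.pureSlot_apply [DecidableEq ι] (x : ∀ i, E i) (i : ι) (y : E i) :
    PiHilbert.pureSlot x i y = PiHilbert.pure (Function.update x i y) := rfl

/-- Totality passes to tensor products: with the other slots frozen, the functional is continuous
and linear in one slot, so the constraint `x i ∈ S i` can be dropped slot by slot. -/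
theorem PiHilbert.functional_eq_zero (S : ∀ i, Set (E i))
    (hS : ∀ i, ∀ g : E i →L[ℂ] ℂ, (∀ v ∈ S i, g v = 0) → g = 0) (f : PiHilbert E →L[ℂ] ℂ)
    (hf : ∀ x : ∀ i, E i, (∀ i, x i ∈ S i) → f (PiHilbert.pure x) = 0) : f = 0 := by
  classical
  -- Here `s` is the set of slots already freed from the constraint.
  have key : ∀ s : Finset ι, ∀ x : ∀ i, E i, (∀ i ∉ s, x i ∈ S i) → f (PiHilbert.pure x) = 0 := by
    intro s
    induction s using Finset.induction_on with
    | empty => exact fun x hx => hf x fun i => hx i (Finset.notMem_empty i)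
    | insert i s hi ih =>
      intro x hx
      have h0 : f.comp (PiHilbert.pureSlot x i) = 0 := hS i _ fun v hv => by
        rw [ContinuousLinearMap.comp_apply, PiHilbert.pureSlot_apply]
        refine ih _ fun j hj => ?_
        by_cases hji : j = i
        · subst hji
          simpa using hv
        · rw [Function.update_of_ne hji]
          exact hx j (by simp [hji, hj])
      have h1 := congrArg (fun g : E i →L[ℂ] ℂ => g (x i)) h0
      simpa [PiHilbert.pureSlot_apply] using h1
  ext z
  induction z using UniformSpace.Completion.induction_on with
  | hp => exact isClosed_eq f.continuous continuous_const
  | ih z =>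
    obtain ⟨c, rfl⟩ := Alg.exists_rep z
    have : ((∑ k : c.support, c k • Alg.tprod E k : Alg E) : PiHilbert E)
        = ∑ k : c.support, c k • PiHilbert.pure (k : ∀ i, E i) :=
      (map_sum (UniformSpace.Completion.toComplL (𝕜 := ℂ) (E := Alg E)) _ _).trans
        (Finset.sum_congr rfl fun k _ => map_smul _ _ _)
    rw [this, map_sum]
    refine Finset.sum_eq_zero fun k _ => ?_
    rw [map_smul, key Finset.univ k (by simp), smul_zero]

end Pi

section Binary

variable {E F : Type*} [NormedAddCommGroup E] [InnerProductSpace ℂ E]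
  [NormedAddCommGroup F] [InnerProductSpace ℂ F]

/-- The elementary tensors in the Hilbert space tensor product. -/
noncomputable def Tensor.pure (x : E) (y : F) : Tensor E F := (x ⊗ₜ[ℂ] y : E ⊗[ℂ] F)

theorem Tensor.inner_pure (x x' : E) (y y' : F) :
    ⟪Tensor.pure x y, Tensor.pure x' y'⟫_ℂ = ⟪x, x'⟫_ℂ * ⟪y, y'⟫_ℂ := by
  rw [Tensor.pure, Tensor.pure, UniformSpace.Completion.inner_coe, TensorProduct.inner_tmul]

theorem Tensor.norm_pure (x : E) (y : F) : ‖Tensor.pure x y‖ = ‖x‖ * ‖y‖ := by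
  rw [Tensor.pure, UniformSpace.Completion.norm_coe, TensorProduct.norm_tmul]

theorem Tensor.map_pure (A : E →L[ℂ] E) (B : F →L[ℂ] F) (x : E) (y : F) :
    Tensor.map A B (Tensor.pure x y) = Tensor.pure (A x) (B y) := by
  rw [Tensor.map, Tensor.pure, ContinuousLinearMap.completion_apply_coe]
  rfl

/-- Elementary tensors as a continuous linear function of the second slot. -/
noncomputable def Tensor.pureRight (x : E) : F →L[ℂ] Tensor E F :=
  UniformSpace.Completion.toComplL.comp
    ((TensorProduct.mk ℂ E F x).mkContinuous ‖x‖ fun y => (TensorProduct.norm_tmul x y).le)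

/-- Elementary tensors as a continuous linear function of the first slot. -/
noncomputable def Tensor.pureLeft (y : F) : E →L[ℂ] Tensor E F :=
  UniformSpace.Completion.toComplL.comp
    (((TensorProduct.mk ℂ E F).flip y).mkContinuous ‖y‖ fun x => by
      rw [mul_comm]
      exact (TensorProduct.norm_tmul x y).le)

theorem Tensor.pureLeft_apply (x : E) (y : F) : Tensor.pureLeft y x = Tensor.pure x y := rfl

theorem Tensor.functional_eq_zero (f : Tensor E F →L[ℂ] ℂ)
    (hf : ∀ x y, f (Tensor.pure x y) = 0) : f = 0 := by
  ext z
  induction z using UniformSpace.Completion.induction_on with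
  | hp => exact isClosed_eq f.continuous continuous_const
  | ih z =>
    induction z using TensorProduct.induction_on with
    | zero => rw [UniformSpace.Completion.coe_zero, map_zero, map_zero]
    | tmul x y => exact hf x y
    | add z w hz hw => rw [UniformSpace.Completion.coe_add, map_add, hz, hw, map_add]

end Binary

end HTensor

namespace StarPPI

/-! ### The standard basis of the model spaces -/

/-- The standard basis vectors of the space attached to a label (zero if out of range). -/
noncomputable def Label.vec : ∀ l : Label, ℕ → l.space
  | .u => fun _ => (0 : EuclideanSpace ℂ (Fin 0))
  | .s => fun k => (lp.single 2 k 1 : Ell2)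
  | .b => fun k => (lp.single 2 k 1 : Ell2)
  | .trunc p => fun k =>
      (if h : k < p then EuclideanSpace.single ⟨k, h⟩ 1 else 0 : EuclideanSpace ℂ (Fin p))

theorem Label.le_len_trunc {p : ℕ+} {k : ℕ} : (k : ℕ∞) ≤ (Label.trunc p).len ↔ k < p := by
  have := PNat.natPred_add_one p
  simp only [Label.len, Nat.cast_le]
  omega

theorem inner_single_ell2 (k k' : ℕ) :
    ⟪(lp.single 2 k 1 : Ell2), (lp.single 2 k' 1 : Ell2)⟫_ℂ = if k = k' then 1 else 0 := by
  rw [lp.inner_single_left]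
  by_cases h : k = k'
  · subst h
    simp
  · simp [h]

theorem Label.inner_vec {l : Label} (hl : l ≠ .u) {k k' : ℕ} (hk : (k : ℕ∞) ≤ l.len)
    (hk' : (k' : ℕ∞) ≤ l.len) : ⟪l.vec k, l.vec k'⟫_ℂ = if k = k' then 1 else 0 := by
  cases l with
  | u => exact absurd rfl hl
  | s => exact inner_single_ell2 k k'
  | b => exact inner_single_ell2 k k'
  | trunc p =>
    rw [Label.le_len_trunc] at hk hk'
    have h1 : (Label.trunc p).vec k = (EuclideanSpace.single ⟨k, hk⟩ 1 : EuclideanSpace ℂ (Fin p)) :=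
      dif_pos hk
    have h2 : (Label.trunc p).vec k'
        = (EuclideanSpace.single ⟨k', hk'⟩ 1 : EuclideanSpace ℂ (Fin p)) := dif_pos hk'
    rw [h1, h2]
    change ⟪(EuclideanSpace.single ⟨k, hk⟩ 1 : EuclideanSpace ℂ (Fin p)),
      (EuclideanSpace.single ⟨k', hk'⟩ 1 : EuclideanSpace ℂ (Fin p))⟫_ℂ = _
    rw [EuclideanSpace.inner_single_left]
    simp

theorem ell2_functional_eq_zero (g : Ell2 →L[ℂ] ℂ) (hg : ∀ k, g (lp.single 2 k 1) = 0) : g = 0 := by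
  ext x
  have h := (lp.hasSum_single (by norm_num) x).mapL g
  have h0 : ∀ k, g (lp.single 2 k (x k)) = 0 := fun k => by
    have : (lp.single 2 k (x k) : Ell2) = x k • (lp.single 2 k 1 : Ell2) := by
      rw [← lp.single_smul]
      simp
    rw [this, map_smul, hg, smul_zero]
  simp only [h0] at h
  exact h.unique hasSum_zero

theorem Label.functional_eq_zero (l : Label) (g : l.space →L[ℂ] ℂ)
    (hg : ∀ k : ℕ, k ≤ l.len → g (l.vec k) = 0) : g = 0 := by
  cases l with
  | u =>
    ext x
    have : x = 0 := Subsingleton.elim (α := EuclideanSpace ℂ (Fin 0)) _ _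
    rw [this, map_zero, map_zero]
  | s => exact ell2_functional_eq_zero g fun k => hg k le_top
  | b => exact ell2_functional_eq_zero g fun k => hg k le_top
  | trunc p =>
    have h : ∀ g : EuclideanSpace ℂ (Fin p) →L[ℂ] ℂ,
        (∀ k : Fin p, g (EuclideanSpace.single k 1) = 0) → g = 0 := by
      intro g hg
      refine ContinuousLinearMap.coe_injective
        ((EuclideanSpace.basisFun (Fin p) ℂ).toBasis.ext fun k => ?_)
      simpa using hg k
    refine h g fun k => ?_
    have h1 : (Label.trunc p).vec k = (EuclideanSpace.single k 1 : EuclideanSpace ℂ (Fin p)) :=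
      dif_pos k.2
    rw [← h1]
    exact hg k (Label.le_len_trunc.2 k.2)

theorem shift_single (k : ℕ) :
    shift (lp.single 2 k 1 : Ell2) = (lp.single 2 (k + 1) 1 : Ell2) := by
  ext n
  change shiftFun (lp.single 2 k 1 : Ell2) n = _
  cases n with
  | zero => simp [shiftFun]
  | succ n => simp [shiftFun, Pi.single_apply]

theorem adjoint_shift_single_zero :
    ContinuousLinearMap.adjoint shift (lp.single 2 0 1 : Ell2) = 0 := by
  refine ext_inner_right ℂ fun y => ?_
  rw [ContinuousLinearMap.adjoint_inner_left, lp.inner_single_left, inner_zero_left]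
  change ⟪(1 : ℂ), shiftFun y 0⟫_ℂ = 0
  simp [shiftFun]

theorem adjoint_shift_single_succ (k : ℕ) :
    ContinuousLinearMap.adjoint shift (lp.single 2 (k + 1) 1 : Ell2) = (lp.single 2 k 1 : Ell2) := by
  refine ext_inner_right ℂ fun y => ?_
  rw [ContinuousLinearMap.adjoint_inner_left, lp.inner_single_left, lp.inner_single_left]
  rfl

/-- No bound on `k` is needed: out of range `vec` is zero, which encodes that `J_p` kills the last
basis vector. -/
theorem Label.op_vec {l : Label} (hl : l ≠ .u) (hb : l.dir = false) (k : ℕ) :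
    l.op (l.vec k) = l.vec (k + 1) := by
  cases l with
  | u => exact absurd rfl hl
  | s => exact shift_single k
  | b => simp [Label.dir] at hb
  | trunc p =>
    change truncShift p (if h : k < p then EuclideanSpace.single ⟨k, h⟩ 1 else 0)
      = if h : k + 1 < p then EuclideanSpace.single ⟨k + 1, h⟩ 1 else 0
    ext n
    change (if (n : ℕ) = 0 then (0 : ℂ) else _) = _
    obtain ⟨n, hn⟩ := n
    split_ifs with h1 h2 h3 h3
    all_goals simp_all [Fin.ext_iff]
    all_goals grind

theorem Label.vec_eq_zero {l : Label} {k : ℕ} (h : ¬ (k : ℕ∞) ≤ l.len) : l.vec k = 0 := by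
  cases l with
  | trunc p =>
    rw [Label.le_len_trunc] at h
    exact dif_neg h
  | _ => simp [Label.len] at h

theorem Label.op_vec_zero {l : Label} (hb : l.dir = true) : l.op (l.vec 0) = 0 := by
  cases l with
  | b => exact adjoint_shift_single_zero
  | _ => simp [Label.dir] at hb

theorem Label.op_vec_succ {l : Label} (hb : l.dir = true) (k : ℕ) :
    l.op (l.vec (k + 1)) = l.vec k := by
  cases l with
  | b => exact adjoint_shift_single_succ k
  | _ => simp [Label.dir] at hb

/-! ### The standard decomposition of the model spaces -/

section Model

open HTensor

variable {M : ℕ} (i : Fin M → Label) {N : Type*} [NormedAddCommGroup N] [InnerProductSpace ℂ N]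

/-- The standard basis vectors of `⨂_{n ∈ Σ_i} K_{i,n}`. -/
noncomputable def slotVec (k : Fin M → ℕ) : SlotSpace i :=
  PiHilbert.pure fun n : Slots i => (i n).vec (k n)

/-- The numbers of the basis vectors of `⨂_{n ∈ Σ_i} K_{i,n}`. -/
abbrev SlotIndex : Type := {k : Fin M → ℕ // ∀ m, (i m).Valid (k m)}

variable {i} in
theorem norm_slotVec (k : SlotIndex i) : ‖slotVec i k‖ = 1 := by
  rw [slotVec, PiHilbert.norm_pure]
  refine Finset.prod_eq_one fun n _ => ?_
  have h := Label.inner_vec n.2 (k.2 n).1 (k.2 n).1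
  rw [if_pos rfl, HTensor.inner_self_eq] at h
  have h' : ‖(i n).vec (k.1 n)‖ ^ 2 = 1 := by exact_mod_cast h
  exact (pow_eq_one_iff_of_nonneg (norm_nonneg _) two_ne_zero).1 h'

variable {i} in
theorem inner_slotVec {k k' : SlotIndex i} (h : k ≠ k') : ⟪slotVec i k, slotVec i k'⟫_ℂ = 0 := by
  have h' : k.1 ≠ k'.1 := fun h' => h (Subtype.ext h')
  obtain ⟨m, hm⟩ := Function.ne_iff.1 h'
  -- Valid positions are `0` at every label `u`, so two of them can only differ at an actual slot.
  have hu : i m ≠ .u := fun hu => hm (by rw [(k.2 m).2 hu, (k'.2 m).2 hu])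
  rw [slotVec, slotVec, PiHilbert.inner_pure]
  refine Finset.prod_eq_zero (Finset.mem_univ ⟨m, hu⟩) ?_
  rw [Label.inner_vec hu (k.2 m).1 (k'.2 m).1, if_neg hm]

variable (N) in
/-- The isometry `x ↦ e_k ⊗ x`. -/
noncomputable def modelEmb (k : SlotIndex i) : N →ₗᵢ[ℂ] Tensor (SlotSpace i) N where
  toLinearMap := (Tensor.pureRight (slotVec i k)).toLinearMap
  norm_map' x := by
    change ‖Tensor.pure (slotVec i k) x‖ = _
    rw [Tensor.norm_pure, norm_slotVec, one_mul]

theorem modelEmb_apply (k : SlotIndex i) (x : N) :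
    modelEmb i N k x = Tensor.pure (slotVec i k) x := rfl

/-- A vector `z` orthogonal to all `e_k ⊗ x` gives the functional `⟪z, ·⟫`, which is shown to vanish
using totality of the basis in each slot. -/
theorem topologicalClosure_iSup_range_modelEmb [CompleteSpace N] :
    (⨆ k, (modelEmb i N k).range).topologicalClosure = ⊤ := by
  rw [Submodule.topologicalClosure_eq_top_iff, Submodule.eq_bot_iff]
  intro z hz
  have h0 : ∀ (k : SlotIndex i) (x : N), ⟪z, Tensor.pure (slotVec i k) x⟫_ℂ = 0 := fun k x =>
    Submodule.inner_left_of_mem_orthogonal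
      (Submodule.mem_iSup_of_mem (p := fun k => (modelEmb i N k).range) k
        (LinearMap.mem_range_self _ x)) hz
  have hz0 : innerSL ℂ z = 0 := by
    refine Tensor.functional_eq_zero _ fun u x => ?_
    have : (innerSL ℂ z).comp (Tensor.pureLeft x) = 0 := by
      refine PiHilbert.functional_eq_zero
        (fun n : Slots i => {v | ∃ k : ℕ, (k : ℕ∞) ≤ (i n).len ∧ v = (i n).vec k})
        (fun n g hg => Label.functional_eq_zero _ g fun k hk => hg _ ⟨k, hk, rfl⟩) _ fun v hv => ?_
      choose k hk hkv using hv
      classical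
      -- The positions chosen on the slots are extended by `0` at the labels `u`, as validity
      -- demands.
      let k' : SlotIndex i := ⟨fun m => if h : i m ≠ .u then k ⟨m, h⟩ else 0, fun m => by
        by_cases h : i m = .u
        · simp [h, Label.Valid]
        · simp only [h, ne_eq, not_false_eq_true, dif_pos]
          exact ⟨hk ⟨m, h⟩, fun h' => absurd h' h⟩⟩
      have hv' : PiHilbert.pure v = slotVec i k' := by
        refine congrArg _ (funext fun n => ?_)
        rw [hkv n]
        simp [k', n.2]
      rw [ContinuousLinearMap.comp_apply, Tensor.pureLeft_apply, hv']
      exact h0 k' x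
    exact congrArg (fun g : SlotSpace i →L[ℂ] ℂ => g u) this
  have := congrArg (fun g : Tensor (SlotSpace i) N →L[ℂ] ℂ => g z) hz0
  simpa using this

theorem isHilbertSum_modelEmb [CompleteSpace N] :
    IsHilbertSum ℂ (fun _ : SlotIndex i => N) (modelEmb i N) := by
  refine IsHilbertSum.mk (fun k k' h x y => ?_) (topologicalClosure_iSup_range_modelEmb i).ge
  rw [modelEmb_apply, modelEmb_apply, Tensor.inner_pure, inner_slotVec h, zero_mul]

variable (V : {m : Fin M // i m = Label.u} → N →L[ℂ] N) (k : Fin M → ℕ) (x : N)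

theorem modelOp_pure_u {m : Fin M} (hm : i m = .u) :
    modelOp i V m (Tensor.pure (slotVec i k) x) = Tensor.pure (slotVec i k) (V ⟨m, hm⟩ x) := by
  rw [modelOp, dif_pos hm, Tensor.map_pure]
  rfl

theorem modelOp_pure {m : Fin M} (hm : i m ≠ .u) :
    modelOp i V m (Tensor.pure (slotVec i k) x) = Tensor.pure (PiHilbert.pure (Function.update
      (fun n : Slots i => (i n).vec (k n)) ⟨m, hm⟩ ((i m).op ((i m).vec (k m))))) x := by
  rw [modelOp, dif_neg hm, Tensor.map_pure, slotOp, slotVec, PiHilbert.map_pure]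
  refine congrArg₂ _ (congrArg _ (funext fun n => ?_)) rfl
  by_cases hn : n = ⟨m, hm⟩
  · subst hn
    simp
  · simp [hn]

theorem modelOp_pure_of_op_eq {m : Fin M} (hm : i m ≠ .u) {k' : Fin M → ℕ}
    (h : (i m).op ((i m).vec (k m)) = (i m).vec (k' m)) (hk : ∀ n, n ≠ m → k' n = k n) :
    modelOp i V m (Tensor.pure (slotVec i k) x) = Tensor.pure (slotVec i k') x := by
  rw [modelOp_pure i V k x hm, slotVec]
  refine congrArg₂ _ (congrArg _ (funext fun n => ?_)) rfl
  by_cases hn : n = ⟨m, hm⟩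
  · subst hn
    simp [h]
  · have hn' : (n : Fin M) ≠ m := fun h => hn (Subtype.ext h)
    simp [hn, hk n hn']

theorem modelOp_pure_of_op_eq_zero {m : Fin M} (hm : i m ≠ .u)
    (h : (i m).op ((i m).vec (k m)) = 0) :
    modelOp i V m (Tensor.pure (slotVec i k) x) = 0 := by
  rw [modelOp_pure i V k x hm, PiHilbert.pure_eq_zero (i := ⟨m, hm⟩) (by simp [h]),
    ← Tensor.pureLeft_apply, map_zero]

end Model

/-- An orthogonal family is the image of a Hilbert sum with the same summands under an isometry. -/
theorem exists_isometry_of_isHilbertSum {κ N K H : Type*} [NormedAddCommGroup N]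
    [InnerProductSpace ℂ N] [CompleteSpace N] [NormedAddCommGroup K] [InnerProductSpace ℂ K]
    [CompleteSpace K] [NormedAddCommGroup H] [InnerProductSpace ℂ H] [CompleteSpace H]
    {J : κ → N →ₗᵢ[ℂ] K} (hJ : IsHilbertSum ℂ (fun _ => N) J) {W : κ → N →ₗᵢ[ℂ] H}
    (hW : OrthogonalFamily ℂ (fun _ => N) W) :
    ∃ Ψ : K →ₗᵢ[ℂ] H, (∀ k x, Ψ (J k x) = W k x) ∧
      Ψ.range = (⨆ k, (W k).range).topologicalClosure := by
  classical
  refine ⟨hW.linearIsometry.comp hJ.linearIsometryEquiv.toLinearIsometry, fun k x => ?_, ?_⟩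
  · have h : hJ.linearIsometryEquiv (J k x) = lp.single 2 k x := by
      rw [← hJ.linearIsometryEquiv_symm_apply_single, LinearIsometryEquiv.apply_symm_apply]
    change hW.linearIsometry (hJ.linearIsometryEquiv (J k x)) = _
    rw [h, hW.linearIsometry_apply_single]
  · rw [← hW.range_linearIsometry]
    ext y
    constructor
    · rintro ⟨z, rfl⟩
      exact ⟨_, rfl⟩
    · rintro ⟨z, rfl⟩
      exact ⟨hJ.linearIsometryEquiv.symm z, by simp⟩

open HTensor

/-! ### Restrictions and unitary equivalence -/

section General

variable {H : Type*} [NormedAddCommGroup H] [InnerProductSpace ℂ H]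

/-- As the subspace is reducing, the adjoint of the restriction is the restriction of the adjoint.
-/
theorem restrict_mem_unitary [CompleteSpace H] {K : Submodule ℂ H} [CompleteSpace K] {A : H →L[ℂ] H}
    (hA : ∀ x ∈ K, A x ∈ K) (hA' : ∀ x ∈ K, star A x ∈ K) (h1 : ∀ x ∈ K, star A (A x) = x)
    (h2 : ∀ x ∈ K, A (star A x) = x) : A.restrict hA ∈ unitary (K →L[ℂ] K) := by
  have hs : star (A.restrict hA) = (star A).restrict hA' := by
    rw [ContinuousLinearMap.star_eq_adjoint]
    refine ((ContinuousLinearMap.eq_adjoint_iff _ _).2 fun x y => ?_).symm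
    exact ContinuousLinearMap.adjoint_inner_left A (y : H) (x : H)
  rw [Unitary.mem_iff, hs]
  exact ⟨ContinuousLinearMap.ext fun x => Subtype.ext (h1 x x.2),
    ContinuousLinearMap.ext fun x => Subtype.ext (h2 x x.2)⟩

theorem simUnitarilyEquiv_of_isometry {ι K : Type*} [NormedAddCommGroup K] [InnerProductSpace ℂ K]
    {T : ι → H →L[ℂ] H} {S : ι → K →L[ℂ] K} {L : Submodule ℂ H} (hL : ∀ m, ∀ x ∈ L, T m x ∈ L)
    {Ψ : K →ₗᵢ[ℂ] H} (hΨ : Ψ.range = L) (h : ∀ m z, T m (Ψ z) = Ψ (S m z)) :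
    SimUnitarilyEquiv (fun m => (T m).restrict (hL m)) S := by
  subst hΨ
  refine ⟨Ψ.equivRange.symm, fun m z => ?_⟩
  rw [LinearIsometryEquiv.symm_symm, LinearIsometryEquiv.symm_apply_eq]
  exact Subtype.ext (h m z)

theorem mem_topologicalClosure_of_mapsTo {A : H →L[ℂ] H} {K : Submodule ℂ H}
    (h : ∀ x ∈ K, A x ∈ K.topologicalClosure) :
    ∀ x ∈ K.topologicalClosure, A x ∈ K.topologicalClosure := by
  have : K.topologicalClosure ≤ K.topologicalClosure.comap (A : H →ₗ[ℂ] H) :=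
    Submodule.topologicalClosure_minimal _ h
      (K.isClosed_topologicalClosure.preimage A.continuous)
  exact this

end General

/-! ### The reducing subspaces and their models -/

section Orbit

variable {M : ℕ} {H : Type*} [NormedAddCommGroup H] [InnerProductSpace ℂ H] [CompleteSpace H]
  {T : Fin M → H →L[ℂ] H}

theorem isClosed_orbitSpace (i : Fin M → Label) (k : Fin M → ℕ) :
    IsClosed (orbitSpace T i k : Set H) := isClosed_jointLevel

instance (i : Fin M → Label) (k : Fin M → ℕ) : CompleteSpace (orbitSpace T i k) :=
  (isClosed_orbitSpace i k).completeSpace_coe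

variable (T) in
/-- The reducing subspace attached to a family of labels. -/
noncomputable def labelSpace (i : Fin M → Label) : Submodule ℂ H :=
  (⨆ k : SlotIndex i, orbitSpace T i k).topologicalClosure

theorem orbitSpace_le_labelSpace {i : Fin M → Label} {k : Fin M → ℕ}
    (hk : ∀ m, (i m).Valid (k m)) : orbitSpace T i k ≤ labelSpace T i :=
  le_trans (le_iSup (fun k : SlotIndex i => orbitSpace T i k) ⟨k, hk⟩)
    (Submodule.le_topologicalClosure _)

instance (i : Fin M → Label) : CompleteSpace (labelSpace T i) :=
  (Submodule.isClosed_topologicalClosure _).completeSpace_coe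

theorem valid_add_single {i : Fin M → Label} {k : Fin M → ℕ} {m : Fin M}
    (hk : ∀ m, (i m).Valid (k m)) (hm : i m ≠ .u) (hkm : ((k m + 1 : ℕ) : ℕ∞) ≤ (i m).len)
    (n : Fin M) : (i n).Valid ((k + Pi.single m 1 : Fin M → ℕ) n) := by
  by_cases hn : n = m
  · subst hn
    exact ⟨by simpa using hkm, fun h => absurd h hm⟩
  · simpa [hn] using hk n

theorem exists_eq_add_single {i : Fin M → Label} {k : Fin M → ℕ} {m : Fin M}
    (hk : ∀ m, (i m).Valid (k m)) (hkm : k m ≠ 0) :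
    ∃ k' : Fin M → ℕ, k = k' + Pi.single m 1 ∧ (∀ m, (i m).Valid (k' m)) ∧
      ((k' m + 1 : ℕ) : ℕ∞) ≤ (i m).len := by
  have h : k = (k - Pi.single m 1) + Pi.single m 1 := by
    funext n
    by_cases hn : n = m
    · subst hn
      simp
      omega
    · simp [hn]
  refine ⟨k - Pi.single m 1, h, fun n => ⟨le_trans ?_ (hk n).1, fun hn => ?_⟩, ?_⟩
  · simp
  · simp [(hk n).2 hn]
  · have h1 := (hk m).1
    have h2 : k m = (k - Pi.single m 1 : Fin M → ℕ) m + 1 := by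
      simp
      omega
    rwa [h2] at h1

variable (hT : ∀ m, IsPowerPartialIsometry (T m)) (hcomm : StarCommuting T) (i : Fin M → Label)

include hT hcomm

theorem signedOp_mem_orbitSpace_of_u {k : Fin M → ℕ} {m : Fin M} (hm : i m = .u) (d : Bool) {x : H}
    (hx : x ∈ orbitSpace T i k) : signedOp T (m, d) x ∈ orbitSpace T i k := by
  have := signedOp_mem hT hcomm (m := m) (d := d) (by simp [orbitPos, hm, Label.pos_u]) hx
  rwa [step_orbitPos_u i k m hm] at this

/-- By continuity it suffices to treat one orbit position, where the operator fixes the position,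
kills the vector, or moves to a neighbouring valid position of the same label. -/
theorem signedOp_mem_labelSpace (m : Fin M) (d : Bool) :
    ∀ x ∈ labelSpace T i, signedOp T (m, d) x ∈ labelSpace T i := by
  refine mem_topologicalClosure_of_mapsTo ?_
  change (⨆ k : SlotIndex i, orbitSpace T i k)
    ≤ (labelSpace T i).comap (signedOp T (m, d) : H →ₗ[ℂ] H)
  refine iSup_le fun ⟨k, hk⟩ x hx => ?_
  change signedOp T (m, d) x ∈ labelSpace T i
  by_cases hm : i m = .u
  · exact orbitSpace_le_labelSpace hk (signedOp_mem_orbitSpace_of_u hT hcomm i hm d hx)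
  by_cases h0 : orbitPos i k (m, d) = 0
  · rw [signedOp_eq_zero hT h0 hx]
    exact zero_mem _
  have hmem := signedOp_mem hT hcomm h0 hx
  by_cases hd : d = (i m).dir
  · subst hd
    rw [step_orbitPos_dir] at hmem
    refine orbitSpace_le_labelSpace (valid_add_single hk hm ?_) hmem
    simp only [orbitPos, Label.pos_dir] at h0
    rw [tsub_eq_zero_iff_le, not_le] at h0
    push_cast
    exact Order.add_one_le_of_lt h0
  · have hd' : d = !(i m).dir := by
      generalize (i m).dir = e at hd
      cases d <;> cases e <;> simp_all
    subst hd'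
    -- Away from `u` the backward level is `k m` itself; being nonzero, it provides a preceding
    -- position.
    have hbase : (i m).base = 0 := by
      generalize i m = l at hm
      cases l <;> simp_all [Label.base]
    simp only [orbitPos, Label.pos_not_dir, hbase, zero_add] at h0
    obtain ⟨k', rfl, hk', hlen⟩ := exists_eq_add_single hk (m := m) (by exact_mod_cast h0)
    rw [step_orbitPos_not_dir i k' m hm hlen] at hmem
    exact orbitSpace_le_labelSpace hk' hmem

theorem reducing_labelSpace (m : Fin M) : Reducing (labelSpace T i) (T m) :=
  ⟨signedOp_mem_labelSpace hT hcomm i m false, signedOp_mem_labelSpace hT hcomm i m true⟩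

/-- Orthogonality comes from injectivity of the passage from labels and positions to levels,
totality from its surjectivity. -/
theorem isHilbertSum_labelSpace :
    IsHilbertSum ℂ (fun i => labelSpace T i) (fun i => (labelSpace T i).subtypeₗᵢ) := by
  have hE := isProjChain_signedChain hT
  refine IsHilbertSum.mkInternal _ ?_ ?_
  · refine OrthogonalFamily.of_pairwise fun i i' hii => ?_
    change labelSpace T i ⟂ labelSpace T i'
    rw [labelSpace, labelSpace, Submodule.IsOrtho, Submodule.orthogonal_closure]
    refine Submodule.topologicalClosure_minimal _ ?_ (Submodule.isClosed_orthogonal _)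
    change _ ⟂ _
    rw [Submodule.isOrtho_iSup_left]
    intro k
    rw [Submodule.isOrtho_iSup_right]
    intro k'
    rw [Submodule.isOrtho_iff_inner_eq]
    exact fun x hx y hy => inner_jointLevel_eq_zero hE
      (fun h => hii (orbitPos_injective k.2 k'.2 h).1) hx hy
  · rw [top_le_iff, Submodule.topologicalClosure_eq_top_iff, Submodule.eq_bot_iff]
    intro y hy
    refine eq_zero_of_forall_jointLevel hE (commute_signedChain hT hcomm) fun α x hx => ?_
    obtain ⟨i, k, hk, rfl⟩ := exists_orbitPos_eq α
    exact Submodule.inner_right_of_mem_orthogonal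
      (Submodule.mem_iSup_of_mem i (orbitSpace_le_labelSpace hk hx)) hy

omit hT in
-- The letter at `m` is `T m` itself, since the direction of `u` is `false`; the other letters
-- commute with it by star-commutation.
theorem commute_orbitWord {m : Fin M} (hm : i m = .u) (k : Fin M → ℕ) :
    Commute (T m) (orbitWord hcomm i k) := by
  refine commute_word _ _ (fun n => ?_) k
  by_cases hn : m = n
  · subst hn
    simp [hm, Label.dir, signedOp]
  · exact commute_signedOp hcomm hn false _

/-- The isometry that moves the cyclic vectors to the vectors number `k` of their orbits. -/
noncomputable def orbitEmb (k : SlotIndex i) : orbitSpace T i 0 →ₗᵢ[ℂ] H where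
  toLinearMap := (orbitWord hcomm i k : H →ₗ[ℂ] H).comp (orbitSpace T i 0).subtype
  norm_map' x := ((orbitWord_spec hT hcomm i k k.2).1 x x.2).2

theorem orbitEmb_apply (k : SlotIndex i) (x : orbitSpace T i 0) :
    orbitEmb hT hcomm i k x = orbitWord hcomm i k x := rfl

theorem orbitEmb_mem (k : SlotIndex i) (x : orbitSpace T i 0) :
    orbitEmb hT hcomm i k x ∈ orbitSpace T i k := ((orbitWord_spec hT hcomm i k k.2).1 x x.2).1

theorem range_orbitEmb (k : SlotIndex i) : (orbitEmb hT hcomm i k).range = orbitSpace T i k := by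
  ext y
  constructor
  · rintro ⟨x, rfl⟩
    exact orbitEmb_mem hT hcomm i k x
  · intro hy
    obtain ⟨x, hx, rfl⟩ := (orbitWord_spec hT hcomm i k k.2).2 y hy
    exact ⟨⟨x, hx⟩, rfl⟩

theorem orthogonalFamily_orbitEmb :
    OrthogonalFamily ℂ (fun _ : SlotIndex i => orbitSpace T i 0) (orbitEmb hT hcomm i) :=
  fun k k' h x y => inner_jointLevel_eq_zero (isProjChain_signedChain hT)
    (fun h' => h (Subtype.ext (orbitPos_injective k.2 k'.2 h').2))
    (orbitEmb_mem hT hcomm i k x) (orbitEmb_mem hT hcomm i k' y)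

/-- The restrictions of the operators with label `u` to the space of cyclic vectors. -/
noncomputable def cyclicUnitary (m : {m : Fin M // i m = Label.u}) :
    unitary (orbitSpace T i 0 →L[ℂ] orbitSpace T i 0) :=
  ⟨(T m).restrict (fun _ hx => signedOp_mem_orbitSpace_of_u hT hcomm i m.2 false hx),
    restrict_mem_unitary (A := T m) _
      (fun _ hx => signedOp_mem_orbitSpace_of_u hT hcomm i m.2 true hx)
      (fun _ hx => signedOp_not_signedOp (m := m.1) (d := false)
        (by simp [orbitPos, m.2, Label.pos_u]) hx)
      (fun _ hx => signedOp_not_signedOp (m := m.1) (d := true)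
        (by simp [orbitPos, m.2, Label.pos_u]) hx)⟩

/-- On both sides the operator shifts the position by one, or kills the vector exactly at the end of
the orbit; at a label `u` it acts on the cyclic vector alone. -/
theorem orbitEmb_intertwines {Ψ : Tensor (SlotSpace i) (orbitSpace T i 0) →ₗᵢ[ℂ] H}
    (hΨ : ∀ k x, Ψ (modelEmb i _ k x) = orbitEmb hT hcomm i k x) (m : Fin M) (k : SlotIndex i)
    (x : orbitSpace T i 0) :
    T m (Ψ (modelEmb i _ k x)) = Ψ (modelOp i (fun m => (cyclicUnitary hT hcomm i m :
      orbitSpace T i 0 →L[ℂ] orbitSpace T i 0)) m (modelEmb i _ k x)) := by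
  have hΨ' : ∀ (k : Fin M → ℕ) (hk : ∀ m, (i m).Valid (k m)) x,
      Ψ (Tensor.pure (slotVec i k) x) = orbitWord hcomm i k x := fun k hk x => hΨ ⟨k, hk⟩ x
  rw [hΨ]
  obtain ⟨k, hk⟩ := k
  have hmem := orbitEmb_mem hT hcomm i ⟨k, hk⟩ x
  rw [modelEmb_apply, orbitEmb_apply]
  rw [orbitEmb_apply] at hmem
  dsimp only at hmem ⊢
  by_cases hm : i m = .u
  · rw [modelOp_pure_u i _ k x hm, hΨ' k hk]
    exact congrArg (fun B : H →L[ℂ] H => B x) (commute_orbitWord hcomm i hm k).eq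
  cases hd : (i m).dir with
  | false =>
    have hop := Label.op_vec hm hd (k m)
    have hw : T m (orbitWord hcomm i k x) = orbitWord hcomm i (k + Pi.single m 1) x := by
      have h : orbitWord hcomm i (k + Pi.single m 1)
          = signedOp T (m, (i m).dir) * orbitWord hcomm i k := word_add_single _ _ _ _
      rw [h, hd]
      rfl
    by_cases hkm : ((k m + 1 : ℕ) : ℕ∞) ≤ (i m).len
    · rw [modelOp_pure_of_op_eq i _ k x hm (k' := k + Pi.single m 1) (by simpa using hop)
        (fun n hn => by simp [hn]), hΨ' _ (valid_add_single hk hm hkm), hw]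
    -- At the last position of a truncated shift the basis vector is killed, and the level of `T m`
    -- is `0`.
    · rw [Label.vec_eq_zero hkm] at hop
      rw [modelOp_pure_of_op_eq_zero i _ k x hm hop, map_zero]
      refine signedOp_eq_zero (m := m) (d := false) hT ?_ hmem
      rw [← hd]
      simp only [orbitPos, Label.pos_dir]
      rw [tsub_eq_zero_iff_le]
      push_cast at hkm
      exact Order.le_of_lt_add_one (not_le.1 hkm)
  | true =>
    by_cases hkm : k m = 0
    -- The label is `b`: `S*` kills `e_0`, and at position `0` the level of `T m` is `0`.
    · have hop : (i m).op ((i m).vec (k m)) = 0 := by rw [hkm, Label.op_vec_zero hd]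
      rw [modelOp_pure_of_op_eq_zero i _ k x hm hop, map_zero]
      refine signedOp_eq_zero (m := m) (d := false) hT ?_ hmem
      have hbase : (i m).base = 0 := by
        generalize i m = l at hm
        cases l <;> simp_all [Label.base]
      have : false = !(i m).dir := by rw [hd]; rfl
      rw [this]
      simp [orbitPos, Label.pos_not_dir, hkm, hbase]
    · obtain ⟨k', rfl, hk', hlen⟩ := exists_eq_add_single hk hkm
      rw [modelOp_pure_of_op_eq i _ _ x hm (k' := k')
        (by simpa using Label.op_vec_succ hd (k' m)) (fun n hn => by simp [hn]), hΨ' _ hk']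
      have h : orbitWord hcomm i (k' + Pi.single m 1)
          = signedOp T (m, (i m).dir) * orbitWord hcomm i k' := word_add_single _ _ _ _
      rw [h, mul_apply_eq_comp, hd]
      -- The last letter of the word is the adjoint of `T m`, which `T m` undoes because the adjoint
      -- has nonzero level at `k'`.
      refine signedOp_not_signedOp (m := m) (d := true) ?_ (orbitEmb_mem hT hcomm i ⟨k', hk'⟩ x)
      rw [← hd]
      simp only [orbitPos, Label.pos_dir]
      rw [ne_eq, tsub_eq_zero_iff_le]
      intro h
      have := hlen.trans h
      norm_cast at this
      omega

theorem simUnitarilyEquiv_model :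
    SimUnitarilyEquiv (fun m => (T m).restrict (reducing_labelSpace hT hcomm i m).1)
      (modelOp i fun m => (cyclicUnitary hT hcomm i m :
        orbitSpace T i 0 →L[ℂ] orbitSpace T i 0)) := by
  have hJ := isHilbertSum_modelEmb i (N := orbitSpace T i 0)
  obtain ⟨Ψ, hΨ, hrange⟩ := exists_isometry_of_isHilbertSum hJ (orthogonalFamily_orbitEmb hT hcomm i)
  simp only [range_orbitEmb] at hrange
  refine simUnitarilyEquiv_of_isometry _ hrange fun m => ?_
  set S := modelOp i (fun m => (cyclicUnitary hT hcomm i m :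
    orbitSpace T i 0 →L[ℂ] orbitSpace T i 0)) m with hS
  -- The two continuous maps agree on a closed subspace containing all `e_k ⊗ x`, hence everywhere.
  have hle : (⨆ k, (modelEmb i (orbitSpace T i 0) k).range) ≤ LinearMap.eqLocus
      ((T m).comp Ψ.toContinuousLinearMap : _ →ₗ[ℂ] H)
      (Ψ.toContinuousLinearMap.comp S : _ →ₗ[ℂ] H) := by
    refine iSup_le fun k => ?_
    rintro _ ⟨x, rfl⟩
    exact orbitEmb_intertwines hT hcomm i hΨ m k x
  have hcl := Submodule.topologicalClosure_minimal _ hle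
    (isClosed_eq ((T m).comp Ψ.toContinuousLinearMap).continuous
      (Ψ.toContinuousLinearMap.comp S).continuous)
  intro z
  exact hcl ((topologicalClosure_iSup_range_modelEmb (N := orbitSpace T i 0) i).ge Submodule.mem_top)

end Orbit

end StarPPI

/-! ### The decomposition theorem -/

theorem theorem3p1 {H : Type u} [NormedAddCommGroup H] [InnerProductSpace ℂ H] [CompleteSpace H]
    (M : ℕ) (T : Fin M → H →L[ℂ] H)
    (hT : ∀ m, IsPowerPartialIsometry (T m)) (hcomm : StarCommuting T) :
    ∃ (L : (Fin M → Label) → Submodule ℂ H)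
      (hred : ∀ (i : Fin M → Label) (m : Fin M), Reducing (L i) (T m)),
      (∀ i, IsClosed (L i : Set H)) ∧
      IsHilbertSum ℂ (fun i => L i) (fun i => (L i).subtypeₗᵢ) ∧
      ∃ (N : (Fin M → Label) → Type u) (_ : ∀ i, NormedAddCommGroup (N i))
        (_ : ∀ i, InnerProductSpace ℂ (N i)) (_ : ∀ i, CompleteSpace (N i))
        (V : ∀ i : Fin M → Label, {m : Fin M // i m = Label.u} → unitary (N i →L[ℂ] N i)),
        (∀ i m n, V i m * V i n = V i n * V i m) ∧
        ∀ i, SimUnitarilyEquiv (fun m => (T m).restrict (hred i m).1)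
          (modelOp i fun m => (V i m : N i →L[ℂ] N i)) := by
  refine ⟨labelSpace T, fun i m => reducing_labelSpace hT hcomm i m,
    fun i => Submodule.isClosed_topologicalClosure _, isHilbertSum_labelSpace hT hcomm,
    fun i => orbitSpace T i 0, fun i => inferInstance, fun i => inferInstance,
    fun i => inferInstance, fun i => cyclicUnitary hT hcomm i, fun i m n => ?_,
    fun i => simUnitarilyEquiv_model hT hcomm i⟩
  -- The unitaries are restrictions of the `T m`, so they inherit commutativity.
  refine Subtype.ext (ContinuousLinearMap.ext fun x => Subtype.ext ?_)
  exact congrArg (fun B : H →L[ℂ] H => B x) (hcomm.1 m n)
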